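/- Let $q$ be a power of $2$, let $\overline{\mathbb F_q}$ be an algebraic closure of $\mathbb F_q$, and let $G=PGL(2,q)$, acting by linear fractional transformations $z\mapsto (az+b)/(cz+d)$ on $\mathbb P^1(\overline{\mathbb F_q})=\overline{\mathbb F_q}\cup\{\infty\}$ and by substitution $r(x)\mapsto r((ax+b)/(cx+d))$ on $\mathbb F_q(x)$. A $G$-orbit on $\mathbb P^1(\overline{\mathbb F_q})$ is called regular if it has exactly $|G|$ elements. Let $\Phi(x)=f(x)/g(x)$, with $f,g\in\mathbb F_q[x]$ relatively prime, be a generator of the field of invariants, $\mathbb F_q(x)^G=\mathbb F_q(\Phi)$, with $\deg f=|G|$ and $\deg g<|G|$. For every $\lambda\in\mathbb F_q$ there is $\alpha\in\overline{\mathbb F_q}$ with $\Phi(\alpha)=\lambda$, and for every such $\alpha$ there is $s\in G$ with $s(\alpha)=\alpha^q$. There is a bijection between the points of $\mathbb P^1(\mathbb F_q)=\mathbb F_q\cup\{\infty\}$ and the conjugacy classes of $G$ in which $\infty$ corresponds to the class of the identity and in which $\lambda\in\mathbb F_q$ corresponds to the conjugacy class of $s$, for every $\alpha\in\overline{\mathbb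 F_q}$ with $\Phi(\alpha)=\lambda$ and every $s\in G$ with $s(\alpha)=\alpha^q$. Furthermore, let $\lambda$, $\alpha$ and $s$ be as above, and let $c$ be the leading coefficient of $f$. If $\alpha$ lies in a regular orbit of $G$, then $f(T)-\lambda g(T)$ is $c$ times a product of $|G|/r$ distinct monic irreducible polynomials in $\mathbb F_q[T]$ of degree $r$, where $r$ is the order of $s$. The point $\alpha$ does not lie in a regular orbit if and only if $\alpha\in\mathbb F_{q^2}\setminus\mathbb F_q$, and in that case $f(T)-\lambda g(T)$ is $c$ times a product of $(q^2-q)/2$ distinct monic irreducible polynomials in $\mathbb F_q[T]$ of degree $2$, each occurring with multiplicity $q+1$. -/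

import Mathlib

open Polynomial
open scoped MatrixGroups

noncomputable section

namespace PGLConj

open Classical in
/-- `PGL(2, F)` acts on the projective line `P¹(K) = K ∪ {∞}` over an extension field `K` of `F`:
map `PGL(2, F)` into `PGL(2, K)` and transport the action of the latter on one-dimensional
subspaces of `K²` along `[x : y] ↦ x / y`. -/
instance actionOnLine (F K : Type*) [Field F] [Field K] [Algebra F K] :
    MulAction PGL(2, F) (OnePoint K) :=
  letI : MulAction PGL(2, K) (OnePoint K) :=
    (OnePoint.equivProjectivization K).mulAction PGL(2, K)
  MulAction.compHom (OnePoint K) (Matrix.ProjGenLinGroup.map (n := Fin 2) (algebraMap F K))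

open Classical in
/-- The action is by linear fractional transformations (finite points). -/
theorem mk_smul_coe {F K : Type*} [Field F] [Field K] [Algebra F K]
    (g : GL (Fin 2) F) (z : K) :
    (Matrix.ProjGenLinGroup.mk g : PGL(2, F)) • (z : OnePoint K) =
      if algebraMap F K (g 1 0) * z + algebraMap F K (g 1 1) = 0 then OnePoint.infty
      else (((algebraMap F K (g 0 0) * z + algebraMap F K (g 0 1)) /
        (algebraMap F K (g 1 0) * z + algebraMap F K (g 1 1)) : K) : OnePoint K) :=
  OnePoint.smul_some_eq_ite (g := g.map (algebraMap F K)) (k := z)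

open Classical in
/-- The action is by linear fractional transformations (the point `∞`). -/
theorem mk_smul_infty {F K : Type*} [Field F] [Field K] [Algebra F K] (g : GL (Fin 2) F) :
    (Matrix.ProjGenLinGroup.mk g : PGL(2, F)) • (OnePoint.infty : OnePoint K) =
      if algebraMap F K (g 1 0) = 0 then OnePoint.infty
      else ((algebraMap F K (g 0 0) / algebraMap F K (g 1 0) : K) : OnePoint K) :=
  OnePoint.smul_infty_eq_ite (g.map (algebraMap F K))

/-- A point of `P¹(K)` lies in a regular orbit of `PGL(2, F)`:
its orbit has as many elements as the group. -/
def InRegularOrbit (F : Type*) {K : Type*} [Field F] [Field K] [Algebra F K]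
    (p : OnePoint K) : Prop :=
  Nat.card (MulAction.orbit PGL(2, F) p) = Nat.card PGL(2, F)

/-- The substitution `r(x) ↦ r((a x + b) / (c x + d))` on `F(x)`. -/
def substitute {F : Type*} [Field F] (g : GL (Fin 2) F) (r : RatFunc F) : RatFunc F :=
  r.eval (algebraMap F (RatFunc F))
    ((RatFunc.C (g 0 0) * RatFunc.X + RatFunc.C (g 0 1)) /
      (RatFunc.C (g 1 0) * RatFunc.X + RatFunc.C (g 1 1)))

/-- The set underlying the field `F(x)^G` of invariant rational functions for `G = PGL(2, F)`.
Proportional matrices give the same substitution, so that invariance under all elements of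
`PGL(2, F)` is invariance under all invertible matrices. -/
def invariantFunctions (F : Type*) [Field F] : Set (RatFunc F) :=
  {r | ∀ g : GL (Fin 2) F, substitute g r = r}

/-- `Φ` generates the field of invariants: `F(x)^G = F(Φ)`, where `G = PGL(2, F)`. -/
def IsInvariantGenerator {F : Type*} [Field F] (Φ : RatFunc F) : Prop :=
  invariantFunctions F = (IntermediateField.adjoin F {Φ} : Set (RatFunc F))

open Classical in
/-- The value in `P¹(K)` of a rational function at `z : K`
(`∞` exactly when the reduced denominator vanishes at `z`). -/
def value {F K : Type*} [Field F] [Field K] [Algebra F K] (Φ : RatFunc F) (z : K) : OnePoint K :=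
  if aeval z Φ.denom = 0 then OnePoint.infty
  else ((aeval z Φ.num / aeval z Φ.denom : K) : OnePoint K)

end PGLConj

end

/-! The fibre of `Φ` over `λ` in `F` is the root set of `p = f - λ g`. Invariance of `Φ` means that
a linear substitution multiplies the degree-`|G|` forms `f` and `g` by one common scalar
(`homSubst_eq_of_substitute_eq`), so each `p` is semi-invariant of exact degree `|G| = q³ - q`. Root
counting does the rest. All points of `P¹(F)` have the multiplicity of `∞`, which is `0` for `p`;
elsewhere the stabilizer is nontrivial exactly on the quadratic points. Hence the roots are either
one regular orbit, all simple, or the `q² - q` quadratic points, each of multiplicity `q + 1`.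
Either way a fibre is one orbit, stable under Frobenius, which yields `s`.

The class of `s` is well defined: on a regular orbit because stabilizers are trivial, on the
quadratic points because `s` has trace zero and in characteristic two determinants can be equalized
by scaling. Injectivity is an explicit form of Lang's theorem (`exists_smul_eq_and_conj`): points on
which the same element acts as Frobenius share an orbit. Surjectivity holds because a separable
equation has too many solutions for all to lie in `F` (`exists_smul_eq_frob`). Both need `g` to
vanish nowhere outside `F` (`SemiInvariant.aeval_ne_zero`), where the parity of `q` is decisive.
Factor degrees are Frobenius periods, read off from the order of `s` on regular orbits. -/

noncomputable section

namespace PGLConj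

/-! ### Frobenius and degrees over a finite field -/

section Frobenius

variable (F K : Type*) [Field F] [Finite F] [Field K] [Algebra F K]

/-- The Frobenius endomorphism `x ↦ x ^ |F|` of an extension `K` of the finite field `F`. -/
def frob : K →ₐ[F] K :=
  letI := Fintype.ofFinite F
  FiniteField.frobeniusAlgHom F K

variable {F K}

theorem frob_apply (x : K) : frob F K x = x ^ Nat.card F := by
  let := Fintype.ofFinite F
  rw [Nat.card_eq_fintype_card]
  simp [frob]

theorem frob_iterate_apply (k : ℕ) (x : K) : (frob F K)^[k] x = x ^ Nat.card F ^ k := by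
  induction k with
  | zero => simp
  | succ k ih => rw [Function.iterate_succ_apply', ih, frob_apply, ← pow_mul, pow_succ]

theorem isIntegral_of_frob_iterate {x : K} {k : ℕ} (hk : k ≠ 0) (h : (frob F K)^[k] x = x) :
    IsIntegral F x := by
  refine isAlgebraic_iff_isIntegral.mp ⟨X ^ Nat.card F ^ k - X,
    FiniteField.X_pow_card_pow_sub_X_ne_zero F hk Finite.one_lt_card, ?_⟩
  rw [frob_iterate_apply] at h
  simp [h]

theorem natDegree_minpoly_dvd_iff {x : K} (hx : IsIntegral F x) (k : ℕ) :
    (minpoly F x).natDegree ∣ k ↔ (frob F K)^[k] x = x := by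
  rw [(minpoly.irreducible hx).natDegree_dvd_iff_dvd_X_pow_card_pow_sub_X,
    ← minpoly.isIntegrallyClosed_dvd_iff hx, frob_iterate_apply]
  simp [sub_eq_zero]

theorem frob_eq_self_iff {x : K} : frob F K x = x ↔ x ∈ Set.range (algebraMap F K) := by
  constructor
  · intro h
    have hx : IsIntegral F x := isIntegral_of_frob_iterate one_ne_zero h
    have := (natDegree_minpoly_dvd_iff hx 1).mpr h
    simpa using minpoly.natDegree_eq_one_iff.mp (Nat.dvd_one.mp this)
  · rintro ⟨y, rfl⟩
    exact (frob F K).commutes y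

end Frobenius

/-! ### The action on points outside `F` -/

section Action

variable {F K : Type*} [Field F] [Field K] [Algebra F K]

/-- The linear fractional transformation attached to a matrix, as a function on the field. -/
def moebius (M : GL (Fin 2) F) (z : K) : K :=
  (algebraMap F K (M 0 0) * z + algebraMap F K (M 0 1)) /
    (algebraMap F K (M 1 0) * z + algebraMap F K (M 1 1))

theorem det_ne_zero (M : GL (Fin 2) F) : M 0 0 * M 1 1 - M 0 1 * M 1 0 ≠ 0 := by
  have := M.isUnit.map Matrix.detMonoidHom
  simpa [Matrix.det_fin_two] using this.ne_zero

theorem linear_ne_zero {z : K} (hz : z ∉ Set.range (algebraMap F K)) {c d : F}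
    (h : c ≠ 0 ∨ d ≠ 0) : algebraMap F K c * z + algebraMap F K d ≠ 0 := by
  intro h0
  by_cases hc : c = 0
  · subst hc
    simp_all
  · refine hz ⟨-d / c, ?_⟩
    have : algebraMap F K c ≠ 0 := by simpa using hc
    rw [map_div₀, map_neg, div_eq_iff this]
    linear_combination -h0

theorem denom_ne_zero (M : GL (Fin 2) F) {z : K} (hz : z ∉ Set.range (algebraMap F K)) :
    algebraMap F K (M 1 0) * z + algebraMap F K (M 1 1) ≠ 0 := by
  refine linear_ne_zero hz ?_
  by_contra! h
  exact det_ne_zero M (by simp [h])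

theorem mk_smul_eq_moebius (M : GL (Fin 2) F) {z : K} (hz : z ∉ Set.range (algebraMap F K)) :
    (Matrix.ProjGenLinGroup.mk M : PGL(2, F)) • (z : OnePoint K) = (moebius M z : K) := by
  rw [mk_smul_coe, if_neg (denom_ne_zero M hz), moebius]

theorem mk_smul_eq_coe_iff (M : GL (Fin 2) F) {z w : K} (hz : z ∉ Set.range (algebraMap F K)) :
    (Matrix.ProjGenLinGroup.mk M : PGL(2, F)) • (z : OnePoint K) = (w : OnePoint K) ↔
      algebraMap F K (M 0 0) * z + algebraMap F K (M 0 1) =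
        w * (algebraMap F K (M 1 0) * z + algebraMap F K (M 1 1)) := by
  rw [mk_smul_eq_moebius M hz, OnePoint.coe_eq_coe, moebius, div_eq_iff (denom_ne_zero M hz)]

/-- The class in `PGL(2, F)` of the matrix with rows `(a, b)` and `(c, d)`. -/
def ofEntries (a b c d : F) (h : a * d - b * c ≠ 0) : PGL(2, F) :=
  Matrix.ProjGenLinGroup.mk (Matrix.GeneralLinearGroup.mkOfDetNeZero !![a, b; c, d]
    (by rwa [Matrix.det_fin_two_of]))

theorem exists_ofEntries (s : PGL(2, F)) : ∃ a b c d h, s = ofEntries a b c d h := by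
  obtain ⟨M, rfl⟩ := Matrix.ProjGenLinGroup.mk_surjective s
  refine ⟨M 0 0, M 0 1, M 1 0, M 1 1, det_ne_zero M, ?_⟩
  congr 1
  ext i j
  fin_cases i <;> fin_cases j <;> rfl

theorem ofEntries_smul_eq_coe_iff {a b c d : F} (h : a * d - b * c ≠ 0) {z w : K}
    (hz : z ∉ Set.range (algebraMap F K)) :
    ofEntries a b c d h • (z : OnePoint K) = (w : OnePoint K) ↔
      algebraMap F K a * z + algebraMap F K b =
        w * (algebraMap F K c * z + algebraMap F K d) :=
  mk_smul_eq_coe_iff _ hz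

theorem ofEntries_eq_one_iff {a b c d : F} (h : a * d - b * c ≠ 0) :
    ofEntries a b c d h = 1 ↔ a = d ∧ b = 0 ∧ c = 0 := by
  rw [ofEntries, Matrix.ProjGenLinGroup.mk_eq_one,
    Matrix.GeneralLinearGroup.center_eq_range_scalar]
  constructor
  · rintro ⟨u, hu⟩
    have e (i j) := congrArg (fun g : GL (Fin 2) F => g i j) hu
    have h00 := e 0 0
    have h01 := e 0 1
    have h10 := e 1 0
    have h11 := e 1 1
    simp [Matrix.GeneralLinearGroup.mkOfDetNeZero] at h00 h01 h10 h11
    exact ⟨h00.symm.trans h11, h01.symm, h10.symm⟩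
  · rintro ⟨rfl, rfl, rfl⟩
    have ha : a ≠ 0 := by rintro rfl; simp at h
    refine ⟨Units.mk0 a ha, ?_⟩
    ext i j
    fin_cases i <;> fin_cases j <;> simp [Matrix.GeneralLinearGroup.mkOfDetNeZero]

theorem ofEntries_scale {a b c d : F} (h : a * d - b * c ≠ 0) {k : F} (hk : k ≠ 0)
    (h' : (k * a) * (k * d) - (k * b) * (k * c) ≠ 0) :
    ofEntries (k * a) (k * b) (k * c) (k * d) h' = ofEntries a b c d h := by
  symm
  rw [ofEntries, ofEntries, Matrix.ProjGenLinGroup.mk_eq_mk_iff]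
  refine ⟨Units.mk0 k hk, ?_⟩
  ext i j
  fin_cases i <;> fin_cases j <;>
    simp [Matrix.GeneralLinearGroup.mkOfDetNeZero, Matrix.mul_apply, mul_comm]

theorem affine_not_mem_range {z : K} (hz : z ∉ Set.range (algebraMap F K)) {a : F} (ha : a ≠ 0)
    (b : F) : algebraMap F K a * z + algebraMap F K b ∉ Set.range (algebraMap F K) := by
  rintro ⟨x, hx⟩
  refine linear_ne_zero hz (Or.inl ha) (d := b - x) ?_
  rw [map_sub, hx]
  ring

variable [Finite F]

theorem frob_not_mem_range {z : K} (hz : z ∉ Set.range (algebraMap F K)) :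
    frob F K z ∉ Set.range (algebraMap F K) := by
  rw [← frob_eq_self_iff] at hz ⊢
  exact fun h => hz ((frob F K).injective h)

/-- Frobenius fixes the matrix entries, so it commutes with the action. -/
theorem smul_frob {s : PGL(2, F)} {z w : K} (hz : z ∉ Set.range (algebraMap F K))
    (h : s • (z : OnePoint K) = (w : OnePoint K)) :
    s • ((frob F K z : K) : OnePoint K) = ((frob F K w : K) : OnePoint K) := by
  obtain ⟨a, b, c, d, hd, rfl⟩ := exists_ofEntries s
  rw [ofEntries_smul_eq_coe_iff _ hz] at h
  rw [ofEntries_smul_eq_coe_iff _ (frob_not_mem_range hz)]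
  simpa using congrArg (frob F K) h

theorem not_mem_range_of_smul_eq {s : PGL(2, F)} {z w : K}
    (hz : z ∉ Set.range (algebraMap F K)) (h : s • (z : OnePoint K) = (w : OnePoint K)) :
    w ∉ Set.range (algebraMap F K) := by
  intro hw
  rw [← frob_eq_self_iff] at hw hz
  have h1 := smul_frob (by rwa [← frob_eq_self_iff]) h
  rw [hw, ← h, smul_left_cancel_iff, OnePoint.coe_eq_coe] at h1
  exact hz h1

theorem exists_smul_eq_coe (s : PGL(2, F)) {z : K} (hz : z ∉ Set.range (algebraMap F K)) :
    ∃ w : K, w ∉ Set.range (algebraMap F K) ∧ s • (z : OnePoint K) = (w : OnePoint K) := by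
  obtain ⟨M, rfl⟩ := Matrix.ProjGenLinGroup.mk_surjective s
  have h := mk_smul_eq_moebius M hz
  exact ⟨_, not_mem_range_of_smul_eq hz h, h⟩

theorem pow_smul_eq_frob_iterate {s : PGL(2, F)} {z : K} (hz : z ∉ Set.range (algebraMap F K))
    (h : s • (z : OnePoint K) = ((frob F K z : K) : OnePoint K)) (k : ℕ) :
    s ^ k • (z : OnePoint K) = (((frob F K)^[k] z : K) : OnePoint K) := by
  have key : ∀ k, (frob F K)^[k] z ∉ Set.range (algebraMap F K) ∧
      s • (((frob F K)^[k] z : K) : OnePoint K) =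
        ((frob F K ((frob F K)^[k] z) : K) : OnePoint K) := by
    intro k
    induction k with
    | zero => exact ⟨hz, h⟩
    | succ k ih =>
      rw [Function.iterate_succ_apply']
      exact ⟨frob_not_mem_range ih.1, smul_frob ih.1 ih.2⟩
  induction k with
  | zero => simp
  | succ k ih => rw [pow_succ', mul_smul, ih, (key k).2, Function.iterate_succ_apply']

end Action

/-! ### The order of `PGL(2, F)` -/

section Card

theorem card_PGL_two (F : Type*) [Field F] [Finite F] :
    Nat.card PGL(2, F) = Nat.card F ^ 3 - Nat.card F := by
  let := Fintype.ofFinite F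
  have h1 : Nat.card (GL (Fin 2) F) = Nat.card PGL(2, F) * Nat.card Fˣ := by
    rw [Subgroup.card_eq_card_quotient_mul_card_subgroup (Subgroup.center (GL (Fin 2) F)),
      Matrix.GeneralLinearGroup.center_eq_range_scalar]
    refine congrArg₂ _ (congrArg (fun H : Subgroup (GL (Fin 2) F) => Nat.card (GL (Fin 2) F ⧸ H))
      Matrix.GeneralLinearGroup.center_eq_range_scalar.symm) ?_
    symm
    refine Nat.card_congr (MonoidHom.ofInjective ?_).toEquiv
    intro u v huv
    ext
    simpa using congrArg (fun g : GL (Fin 2) F => g 0 0) huv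
  rw [Matrix.card_GL_field, Nat.card_units, ← Nat.card_eq_fintype_card, Fin.prod_univ_two] at h1
  have hq : 1 < Nat.card F := Finite.one_lt_card
  simp only [Fin.val_zero, Fin.val_one, pow_zero, pow_one] at h1
  obtain ⟨m, hm⟩ : ∃ m, Nat.card F = m + 2 := ⟨Nat.card F - 2, by omega⟩
  rw [hm] at h1 ⊢
  have e1 : (m + 2) ^ 2 - 1 = (m + 3) * (m + 1) := by
    rw [Nat.sub_eq_iff_eq_add (Nat.one_le_pow _ _ (by omega))]; ring
  have e2 : (m + 2) ^ 2 - (m + 2) = (m + 2) * (m + 1) := by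
    rw [Nat.sub_eq_iff_eq_add (by nlinarith)]; ring
  have e3 : (m + 2) ^ 3 - (m + 2) = (m + 3) * ((m + 2) * (m + 1)) := by
    rw [Nat.sub_eq_iff_eq_add (by exact Nat.le_self_pow (by norm_num) _)]; ring
  rw [e1, e2, show m + 2 - 1 = m + 1 by omega] at h1
  rw [e3]
  have := Nat.eq_of_mul_eq_mul_right (by omega : 0 < m + 1)
    (show Nat.card PGL(2, F) * (m + 1) = ((m + 3) * ((m + 2) * (m + 1))) * (m + 1) by
      rw [← h1]; ring)
  exact this

instance (F : Type*) [Field F] [Finite F] : Finite PGL(2, F) :=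
  Finite.of_surjective _ Matrix.ProjGenLinGroup.mk_surjective

end Card

/-! ### An explicit form of Lang's theorem -/

section Conjugation

variable {F K : Type*} [Field F] [Finite F] [Field K] [Algebra F K]

theorem exists_frob_eq_mul [IsAlgClosed K] {x : K} (hx : x ≠ 0) :
    ∃ k : K, k ≠ 0 ∧ frob F K k = x * k := by
  have hq : 1 < Nat.card F := Finite.one_lt_card
  obtain ⟨k, hk⟩ := IsAlgClosed.exists_pow_nat_eq x (show 0 < Nat.card F - 1 by omega)
  refine ⟨k, ?_, ?_⟩
  · rintro rfl
    rw [zero_pow (by omega)] at hk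
    exact hx hk.symm
  · rw [frob_apply, ← hk, ← pow_succ, Nat.sub_add_cancel hq.le]

open Matrix in
/-- A vector `v` over `K` on which the matrix `S` acts as the Frobenius map provides a basis
`v, v ^ q` of `K²` in which both `S` and the Frobenius map have the companion matrix of `S`. -/
theorem exists_frame [IsAlgClosed K] {a b c d : F} (h : a * d - b * c ≠ 0) {z : K}
    (hz : z ∉ Set.range (algebraMap F K))
    (hs : ofEntries a b c d h • (z : OnePoint K) = ((frob F K z : K) : OnePoint K)) :
    ∃ (V : Matrix (Fin 2) (Fin 2) K), IsUnit V ∧ V 0 0 = V 1 0 * z ∧ V 1 0 ≠ 0 ∧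
      V.map (frob F K) = !![a, b; c, d].map (algebraMap F K) * V ∧
      V.map (frob F K) = V * !![0, -(a * d - b * c); 1, a + d].map (algebraMap F K) := by
  rw [ofEntries_smul_eq_coe_iff h hz] at hs
  have hden : algebraMap F K c * z + algebraMap F K d ≠ 0 := by
    refine linear_ne_zero hz ?_
    by_contra! h0
    exact h (by simp [h0])
  -- The matrix sends `(z, 1)` to `(c z + d)(z^q, 1)`. With `k^q = (c z + d) k`, the vector `v = k
  -- (z, 1)` satisfies `S v = v^q`.
  obtain ⟨k, hk0, hk⟩ := exists_frob_eq_mul (F := F) hden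
  have hf : ∀ x : F, frob F K (algebraMap F K x) = algebraMap F K x := (frob F K).commutes
  have hs2 := congrArg (frob F K) hs
  have hk2 := congrArg (frob F K) hk
  simp only [map_add, map_mul, hf] at hs2 hk2
  have hne : frob F K z ≠ z := fun h => hz (frob_eq_self_iff.mp h)
  -- The columns are `v` and `v^q`, independent since `z^q ≠ z`. The last identity is
  -- Cayley–Hamilton: `v^(q²) = S² v = (a + d) v^q - (a d - b c) v`.
  refine ⟨!![k * z, frob F K (k * z); k, frob F K k], ?_, by simp, by simpa, ?_, ?_⟩
  · rw [Matrix.isUnit_iff_isUnit_det, Matrix.det_fin_two_of, isUnit_iff_ne_zero, map_mul]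
    have h1 : frob F K k ≠ 0 := by simpa using hk0
    rw [show k * z * frob F K k - frob F K k * frob F K z * k =
      k * frob F K k * (z - frob F K z) by ring]
    exact mul_ne_zero (mul_ne_zero hk0 h1) (sub_ne_zero.mpr hne.symm)
  · ext i j
    fin_cases i <;> fin_cases j <;> simp [Matrix.mul_apply]
    · rw [hk]; linear_combination (-k) * hs
    · rw [hk2]; linear_combination (- frob F K k) * hs2
    · rw [hk]; ring
    · rw [hk2]; ring
  · ext i j
    fin_cases i <;> fin_cases j <;> simp [Matrix.mul_apply]
    · rw [hk2, hk]
      linear_combination (-(algebraMap F K c * z + algebraMap F K d) * k) * hs2 +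
        algebraMap F K d * k * hs
    · rw [hk2, hk]
      linear_combination -algebraMap F K c * k * hs

-- Equal trace and determinant give both frames the same companion matrix `C`, so the change of
-- frame `T = W V⁻¹` is Frobenius-fixed and therefore defined over `F`.
open Matrix in
theorem exists_smul_eq_and_conj [IsAlgClosed K] {a b c d a' b' c' d' : F}
    (h : a * d - b * c ≠ 0) (h' : a' * d' - b' * c' ≠ 0)
    (htr : a + d = a' + d') (hdet : a * d - b * c = a' * d' - b' * c') {z w : K}
    (hz : z ∉ Set.range (algebraMap F K)) (hw : w ∉ Set.range (algebraMap F K))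
    (hs : ofEntries a b c d h • (z : OnePoint K) = ((frob F K z : K) : OnePoint K))
    (hs' : ofEntries a' b' c' d' h' • (w : OnePoint K) = ((frob F K w : K) : OnePoint K)) :
    ∃ t : PGL(2, F), t • (z : OnePoint K) = (w : OnePoint K) ∧
      t * ofEntries a b c d h * t⁻¹ = ofEntries a' b' c' d' h' := by
  obtain ⟨V, hVu, hV0, hV1, hV2, hV3⟩ := exists_frame h hz hs
  obtain ⟨W, hWu, hW0, hW1, hW2, hW3⟩ := exists_frame h' hw hs'
  rw [← htr, ← hdet] at hW3
  set C : Matrix (Fin 2) (Fin 2) K :=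
    !![0, -(a * d - b * c); 1, a + d].map (algebraMap F K) with hC
  have hCu : IsUnit C := by
    have : IsUnit (!![0, -(a * d - b * c); 1, a + d] : Matrix (Fin 2) (Fin 2) F) := by
      rw [Matrix.isUnit_iff_isUnit_det, Matrix.det_fin_two_of, isUnit_iff_ne_zero]
      simpa using h
    exact this.map (algebraMap F K).mapMatrix
  obtain ⟨V', hV'⟩ := hVu.exists_left_inv
  obtain ⟨T, hT⟩ : ∃ T, T = W * V' := ⟨_, rfl⟩
  have hTV : T * V = W := by rw [hT, mul_assoc, hV', mul_one]
  have hTu : IsUnit T := by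
    rw [← hVu.unit_spec] at hTV
    rw [(Units.eq_mul_inv_iff_mul_eq _).mpr hTV]
    exact hWu.mul (Units.isUnit _)
  -- Frobenius sends `V` and `W` to `V C` and `W C`; the common factor `C` cancels.
  have hTf : T.map (frob F K) = T := by
    have h1 : T.map (frob F K) * V.map (frob F K) = W.map (frob F K) := by
      conv_rhs => rw [← hTV, Matrix.map_mul]
    rw [hV3, hW3, ← mul_assoc] at h1
    rw [← hVu.mul_left_inj, hTV]
    exact hCu.mul_left_inj.mp h1
  have hTr : ∀ i j, ∃ x, algebraMap F K x = T i j := fun i j =>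
    frob_eq_self_iff.mp (congrFun (congrFun hTf i) j)
  choose A hA using hTr
  have hAT : (Matrix.of A).map (algebraMap F K) = T := by ext i j; simp [hA]
  have hinj : Function.Injective
      (fun B : Matrix (Fin 2) (Fin 2) F => B.map (algebraMap F K)) :=
    Matrix.map_injective (algebraMap F K).injective
  -- `T S V = T V C = W C = S' W = S' T V`, and `V` cancels.
  have hcomm : Matrix.of A * !![a, b; c, d] = !![a', b'; c', d'] * Matrix.of A := by
    apply hinj
    simp only [Matrix.map_mul, hAT]
    rw [← hVu.mul_left_inj, mul_assoc, mul_assoc, ← hV2, hTV, hV3, ← mul_assoc, hTV, ← hW3, hW2]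
  have hAdet : A 0 0 * A 1 1 - A 0 1 * A 1 0 ≠ 0 := by
    intro h0
    rw [Matrix.isUnit_iff_isUnit_det, Matrix.det_fin_two, isUnit_iff_ne_zero] at hTu
    apply hTu
    rw [← hA, ← hA, ← hA, ← hA, ← map_mul, ← map_mul, ← map_sub, h0, map_zero]
  refine ⟨ofEntries _ _ _ _ hAdet, ?_, ?_⟩
  · rw [ofEntries_smul_eq_coe_iff _ hz, hA, hA, hA, hA]
    have e0 := congrFun (congrFun hTV 0) 0
    have e1 := congrFun (congrFun hTV 1) 0
    simp only [Matrix.mul_apply, Fin.sum_univ_two, hV0, hW0] at e0 e1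
    rw [← e1] at e0
    apply mul_left_cancel₀ hV1
    linear_combination e0
  · rw [mul_inv_eq_iff_eq_mul]
    simp only [ofEntries, ← map_mul]
    congr 1
    ext i j
    have := congrFun (congrFun hcomm i) j
    fin_cases i <;> fin_cases j <;>
      simpa [Matrix.GeneralLinearGroup.mkOfDetNeZero, Matrix.mul_apply] using this

/-- The solutions outside `F` of `s • z = z ^ q` are permuted transitively. -/
theorem exists_smul_eq_of_smul_eq_frob [IsAlgClosed K] {s : PGL(2, F)} {z w : K}
    (hz : z ∉ Set.range (algebraMap F K)) (hw : w ∉ Set.range (algebraMap F K))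
    (hs : s • (z : OnePoint K) = ((frob F K z : K) : OnePoint K))
    (hs' : s • (w : OnePoint K) = ((frob F K w : K) : OnePoint K)) :
    ∃ t : PGL(2, F), t • (z : OnePoint K) = (w : OnePoint K) := by
  obtain ⟨a, b, c, d, h, rfl⟩ := exists_ofEntries s
  obtain ⟨t, ht, -⟩ := exists_smul_eq_and_conj h h rfl rfl hz hw hs hs'
  exact ⟨t, ht⟩

end Conjugation

/-! ### Stabilizers and quadratic points -/

section QuadraticPoints

variable {F K : Type*} [Field F] [Finite F] [Field K] [Algebra F K]

/-- Both `z` and `z^q` solve the quadratic fixed-point equation, so `c (z + z^q) = a - d`. Applying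
Frobenius and comparing gives `z^(q²) = z`. -/
theorem frob_frob_of_smul_eq_self {t : PGL(2, F)} (ht : t ≠ 1) {z : K}
    (hz : z ∉ Set.range (algebraMap F K)) (h : t • (z : OnePoint K) = (z : OnePoint K)) :
    frob F K (frob F K z) = z := by
  obtain ⟨a, b, c, d, hd, rfl⟩ := exists_ofEntries t
  rw [ofEntries_smul_eq_coe_iff _ hz] at h
  have hf : ∀ x : F, frob F K (algebraMap F K x) = algebraMap F K x := (frob F K).commutes
  have hne : z - frob F K z ≠ 0 := fun h => hz (frob_eq_self_iff.mp (sub_eq_zero.mp h).symm)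
  have hc : c ≠ 0 := by
    rintro rfl
    by_cases had : a = d
    · subst had
      refine ht ((ofEntries_eq_one_iff _).mpr ⟨rfl, ?_, rfl⟩)
      have : algebraMap F K b = 0 := by
        simp only [map_zero, zero_mul, zero_add] at h
        linear_combination h
      simpa using this
    · refine linear_ne_zero hz (c := a - d) (d := b) (Or.inl (sub_ne_zero.mpr had)) ?_
      simp only [map_zero, zero_mul, zero_add] at h
      rw [map_sub]
      linear_combination h
  have hc' : algebraMap F K c ≠ 0 := by simpa using hc
  have h1 := congrArg (frob F K) h
  simp only [map_add, map_mul, hf] at h1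
  have e1 : algebraMap F K c * (z + frob F K z) = algebraMap F K a - algebraMap F K d := by
    apply mul_right_cancel₀ hne
    linear_combination h1 - h
  have e2 := congrArg (frob F K) e1
  simp only [map_add, map_mul, map_sub, hf] at e2
  apply mul_left_cancel₀ hc'
  linear_combination e2 - e1

theorem exists_ne_one_smul_eq_self {z : K} (hz : z ∉ Set.range (algebraMap F K))
    (h : frob F K (frob F K z) = z) :
    ∃ t : PGL(2, F), t ≠ 1 ∧ t • (z : OnePoint K) = (z : OnePoint K) := by
  obtain ⟨u, hu⟩ := frob_eq_self_iff.mp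
    (show frob F K (z + frob F K z) = z + frob F K z by rw [map_add, h, add_comm])
  obtain ⟨v, hv⟩ := frob_eq_self_iff.mp
    (show frob F K (z * frob F K z) = z * frob F K z by rw [map_mul, h, mul_comm])
  have hv0 : v ≠ 0 := by
    rintro rfl
    rw [map_zero, eq_comm, mul_eq_zero, map_eq_zero, or_self] at hv
    exact hz ⟨0, by rw [map_zero, hv]⟩
  -- With `u` the trace and `v` the norm, `z² = u z - v`, so `z` is fixed by `z ↦ (u z - v) / z`.
  refine ⟨ofEntries u (-v) 1 0 (by simpa), ?_, ?_⟩
  · rw [ne_eq, ofEntries_eq_one_iff]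
    simp
  · rw [ofEntries_smul_eq_coe_iff _ hz, hu, map_neg, hv, map_one, map_zero]
    ring

theorem inRegularOrbit_iff {z : K} :
    InRegularOrbit F (z : OnePoint K) ↔
      ∀ t : PGL(2, F), t • (z : OnePoint K) = (z : OnePoint K) → t = 1 := by
  have h1 : Nat.card (MulAction.orbit PGL(2, F) (z : OnePoint K)) *
      Nat.card (MulAction.stabilizer PGL(2, F) (z : OnePoint K)) = Nat.card PGL(2, F) := by
    rw [Nat.card_congr (MulAction.orbitEquivQuotientStabilizer PGL(2, F) (z : OnePoint K)),
      ← Subgroup.card_eq_card_quotient_mul_card_subgroup]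
  have hpos : 0 < Nat.card PGL(2, F) := Nat.card_pos
  rw [InRegularOrbit]
  constructor
  · intro h t ht
    rw [h] at h1
    have h2 := Nat.eq_of_mul_eq_mul_left hpos (h1.trans (mul_one _).symm)
    rw [Subgroup.card_eq_one] at h2
    have : t ∈ MulAction.stabilizer PGL(2, F) (z : OnePoint K) := ht
    rwa [h2, Subgroup.mem_bot] at this
  · intro h
    have : MulAction.stabilizer PGL(2, F) (z : OnePoint K) = ⊥ :=
      (Subgroup.eq_bot_iff_forall _).mpr h
    rw [← h1, this, Subgroup.card_bot, mul_one]

theorem not_inRegularOrbit_iff {z : K} (hz : z ∉ Set.range (algebraMap F K)) :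
    ¬ InRegularOrbit F (z : OnePoint K) ↔ frob F K (frob F K z) = z := by
  rw [inRegularOrbit_iff]
  push Not
  constructor
  · rintro ⟨t, ht, hne⟩
    exact frob_frob_of_smul_eq_self hne hz ht
  · intro h
    obtain ⟨t, hne, ht⟩ := exists_ne_one_smul_eq_self hz h
    exact ⟨t, ht, hne⟩

/-- Two points of the quadratic extension outside `F` are related by an affine map over `F`. -/
theorem exists_affine {z w : K} (hz : z ∉ Set.range (algebraMap F K))
    (hw : w ∉ Set.range (algebraMap F K)) (hz2 : frob F K (frob F K z) = z)
    (hw2 : frob F K (frob F K w) = w) :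
    ∃ a b : F, a ≠ 0 ∧ w = algebraMap F K a * z + algebraMap F K b := by
  have hne : frob F K z - z ≠ 0 := fun h => hz (frob_eq_self_iff.mp (sub_eq_zero.mp h))
  have hne' : frob F K w - w ≠ 0 := fun h => hw (frob_eq_self_iff.mp (sub_eq_zero.mp h))
  -- Frobenius negates both differences, so their quotient lies in `F`.
  obtain ⟨a, ha⟩ := frob_eq_self_iff.mp
    (show frob F K ((frob F K w - w) / (frob F K z - z)) =
        (frob F K w - w) / (frob F K z - z) by
      rw [map_div₀, map_sub, map_sub, hz2, hw2, ← neg_div_neg_eq, neg_sub, neg_sub])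
  have ha' : algebraMap F K a * (frob F K z - z) = frob F K w - w := by
    rw [ha, div_mul_cancel₀ _ hne]
  obtain ⟨b, hb⟩ := frob_eq_self_iff.mp
    (show frob F K (w - algebraMap F K a * z) = w - algebraMap F K a * z by
      rw [map_sub, map_mul, AlgHom.commutes]
      linear_combination -ha')
  refine ⟨a, b, ?_, by rw [hb]; ring⟩
  rintro rfl
  rw [map_zero, zero_mul] at ha'
  exact hne' ha'.symm

/-- The affine group over `F` acts simply transitively on these points. -/
theorem card_quadratic_points {z : K} (hz : z ∉ Set.range (algebraMap F K))
    (hz2 : frob F K (frob F K z) = z) :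
    Nat.card {w : K // w ∉ Set.range (algebraMap F K) ∧ frob F K (frob F K w) = w} =
      (Nat.card F - 1) * Nat.card F := by
  rw [← Nat.card_units, ← Nat.card_prod]
  symm
  refine Nat.card_eq_of_bijective (fun p : Fˣ × F =>
    ⟨algebraMap F K p.1 * z + algebraMap F K p.2, affine_not_mem_range hz p.1.ne_zero p.2, ?_⟩)
    ⟨?_, ?_⟩
  · simp [hz2]
  · rintro ⟨a, b⟩ ⟨a', b'⟩ h
    simp only [Subtype.mk.injEq] at h
    have haa : a = a' := by
      by_contra hne
      refine linear_ne_zero hz (c := a - a') (d := b - b')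
        (Or.inl (sub_ne_zero.mpr fun h => hne (Units.ext h))) ?_
      rw [map_sub, map_sub]
      linear_combination h
    subst haa
    simpa using h
  · rintro ⟨w, hw, hw2⟩
    obtain ⟨a, b, ha, rfl⟩ := exists_affine hz hw hz2 hw2
    exact ⟨(Units.mk0 a ha, b), rfl⟩

end QuadraticPoints

/-! ### Semi-invariant forms and their multiplicities -/

section SemiInvariant

variable {F : Type*} [Field F]

/-- The homogeneous substitution `∑ pᵢ (a X + b) ^ i (c X + d) ^ (N - i)` in a polynomial `p` of
degree at most `N`. -/
def homSubst (N : ℕ) (M : GL (Fin 2) F) (p : F[X]) : F[X] :=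
  ∑ i ∈ Finset.range (N + 1), C (p.coeff i) * (C (M 0 0) * X + C (M 0 1)) ^ i *
    (C (M 1 0) * X + C (M 1 1)) ^ (N - i)

theorem aeval_homSubst {L : Type*} [Field L] [Algebra F L] {N : ℕ} (M : GL (Fin 2) F) {p : F[X]}
    (hp : p.natDegree ≤ N) {z : L}
    (hz : algebraMap F L (M 1 0) * z + algebraMap F L (M 1 1) ≠ 0) :
    aeval z (homSubst N M p) =
      (algebraMap F L (M 1 0) * z + algebraMap F L (M 1 1)) ^ N * aeval (moebius M z) p := by
  rw [aeval_eq_sum_range' (Nat.lt_succ_of_le hp), homSubst, map_sum, Finset.mul_sum]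
  refine Finset.sum_congr rfl fun i hi => ?_
  have hi' : i ≤ N := Nat.lt_succ_iff.mp (Finset.mem_range.mp hi)
  simp only [map_mul, map_pow, map_add, aeval_C, aeval_X, Algebra.smul_def, moebius, div_pow]
  obtain ⟨j, rfl⟩ := Nat.exists_eq_add_of_le hi'
  rw [Nat.add_sub_cancel_left, pow_add]
  generalize algebraMap F L (M 1 0) * z + algebraMap F L (M 1 1) = D at hz
  field_simp

theorem natDegree_homSubst_le (N : ℕ) (M : GL (Fin 2) F) (p : F[X]) :
    (homSubst N M p).natDegree ≤ N := by
  refine natDegree_sum_le_of_forall_le _ _ fun i hi => ?_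
  have hi' : i ≤ N := Nat.lt_succ_iff.mp (Finset.mem_range.mp hi)
  have h1 := natDegree_C_mul_le (p.coeff i) ((C (M 0 0) * X + C (M 0 1)) ^ i)
  have h2 := natDegree_pow_le_of_le i (natDegree_linear_le (a := M 0 0) (b := M 0 1))
  have h3 := natDegree_pow_le_of_le (N - i) (natDegree_linear_le (a := M 1 0) (b := M 1 1))
  have h4 := natDegree_mul_le (p := C (p.coeff i) * (C (M 0 0) * X + C (M 0 1)) ^ i)
    (q := (C (M 1 0) * X + C (M 1 1)) ^ (N - i))
  omega

/-- The polynomial `p`, as a form of degree `N`, spans an invariant line under linear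
substitutions. -/
def SemiInvariant (N : ℕ) (p : F[X]) : Prop :=
  ∀ M : GL (Fin 2) F, ∃ u : F, u ≠ 0 ∧ homSubst N M p = C u * p

theorem homSubst_sub_C_mul (N : ℕ) (M : GL (Fin 2) F) (f g : F[X]) (x : F) :
    homSubst N M (f - C x * g) = homSubst N M f - C x * homSubst N M g := by
  simp only [homSubst, Finset.mul_sum, ← Finset.sum_sub_distrib]
  refine Finset.sum_congr rfl fun i _ => ?_
  simp only [coeff_sub, coeff_C_mul, map_sub, map_mul]
  ring

theorem mul_denom_eq_num_mul {f g : F[X]} (hg : g ≠ 0) {Φ : RatFunc F}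
    (hΦ : Φ = algebraMap F[X] (RatFunc F) f / algebraMap F[X] (RatFunc F) g) :
    f * Φ.denom = Φ.num * g := by
  apply IsFractionRing.injective F[X] (RatFunc F)
  rw [map_mul, map_mul]
  have h1 := (RatFunc.num_div_denom Φ).trans hΦ
  have h2 : algebraMap F[X] (RatFunc F) Φ.denom ≠ 0 := by
    simpa using RatFunc.denom_ne_zero Φ
  have h3 : algebraMap F[X] (RatFunc F) g ≠ 0 := by simpa using hg
  rw [div_eq_div_iff h2 h3] at h1
  exact h1.symm

/-- Cross-multiplied invariance and coprimality make `f` divide its transform. Since `f` has the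
full degree `N`, the quotient is constant, and the same constant serves `g`. -/
theorem homSubst_eq_of_substitute_eq {f g : F[X]} (hfg : IsCoprime f g) {N : ℕ} (hN : 0 < N)
    (hf : f.natDegree = N) (hg : g.natDegree ≤ N) {Φ : RatFunc F}
    (hΦ : Φ = algebraMap F[X] (RatFunc F) f / algebraMap F[X] (RatFunc F) g)
    {M : GL (Fin 2) F} (hM : substitute M Φ = Φ) :
    ∃ u : F, u ≠ 0 ∧ homSubst N M f = C u * f ∧ homSubst N M g = C u * g := by
  have hf0 : f ≠ 0 := by rintro rfl; simp at hf; omega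
  have hinj := IsFractionRing.injective F[X] (RatFunc F)
  by_cases hg0 : g = 0
  · subst hg0
    rw [isCoprime_zero_right] at hfg
    rw [natDegree_eq_zero_of_isUnit hfg] at hf
    omega
  have hg0' : algebraMap F[X] (RatFunc F) g ≠ 0 := by
    simpa using hg0
  have hf0' : algebraMap F[X] (RatFunc F) f ≠ 0 := by
    simpa using hf0
  have hden : algebraMap F (RatFunc F) (M 1 0) * RatFunc.X + algebraMap F (RatFunc F) (M 1 1) ≠ 0 := by
    have : C (M 1 0) * X + C (M 1 1) ≠ 0 := by
      intro h
      have h0 := congrArg (coeff · 0) h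
      have h1 := congrArg (coeff · 1) h
      simp [coeff_C] at h0 h1
      exact det_ne_zero M (by simp [h0, h1])
    have h2 := hinj.ne this
    simpa [RatFunc.algebraMap_eq_C] using h2
  -- Invariance is used at the generic point: `F(x)` is the extension field and `y` the transform of
  -- the variable.
  set y : RatFunc F := moebius M RatFunc.X with hy
  have hΦ0 : Φ ≠ 0 := by rw [hΦ]; exact div_ne_zero hf0' hg0'
  have hsub : aeval y Φ.num = Φ * aeval y Φ.denom := by
    have h1 : aeval y Φ.num / aeval y Φ.denom = Φ := by
      conv_rhs => rw [← hM]
      rfl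
    have h2 : aeval y Φ.denom ≠ 0 := by
      intro h0
      rw [h0, div_zero] at h1
      exact hΦ0 h1.symm
    rwa [div_eq_iff h2] at h1
  have hd0 : aeval y Φ.denom ≠ 0 := by
    intro h0
    rw [h0, mul_zero] at hsub
    obtain ⟨a, b, hab⟩ := RatFunc.isCoprime_num_denom Φ
    have := congrArg (aeval y) hab
    simp [hsub, h0] at this
  have hcross := mul_denom_eq_num_mul hg0 hΦ
  have hy1 : aeval y f = Φ * aeval y g := by
    have := congrArg (aeval y) hcross
    rw [map_mul, map_mul, hsub] at this
    apply mul_right_cancel₀ hd0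
    rw [this]
    ring
  have hX : ∀ p : F[X], aeval (RatFunc.X : RatFunc F) p = algebraMap F[X] (RatFunc F) p :=
    fun p => RatFunc.aeval_X_left_eq_algebraMap p
  have hmain : homSubst N M f * g = f * homSubst N M g := by
    apply hinj
    rw [map_mul, map_mul, ← hX (homSubst N M f), ← hX (homSubst N M g),
      aeval_homSubst M hf.le hden, aeval_homSubst M hg hden, ← hy, hy1, hΦ]
    field_simp
  have hdvd : f ∣ homSubst N M f := hfg.dvd_of_dvd_mul_right ⟨_, hmain⟩
  obtain ⟨h, hh⟩ := hdvd
  have hh' : homSubst N M g = h * g := by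
    apply mul_left_cancel₀ hf0
    rw [← hmain, hh]
    ring
  -- A zero factor would make `f` and `g` both vanish at `y`.
  have hne : h ≠ 0 := by
    rintro rfl
    rw [mul_zero] at hh
    rw [zero_mul] at hh'
    have e1 := aeval_homSubst M hf.le hden
    have e2 := aeval_homSubst M hg hden
    rw [hh, map_zero, eq_comm, mul_eq_zero, or_iff_right (pow_ne_zero _ hden)] at e1
    rw [hh', map_zero, eq_comm, mul_eq_zero, or_iff_right (pow_ne_zero _ hden)] at e2
    obtain ⟨a, b, hab⟩ := hfg
    have := congrArg (aeval (moebius M (RatFunc.X : RatFunc F))) hab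
    simp [e1, e2] at this
  have hdeg : h.natDegree = 0 := by
    have := natDegree_homSubst_le N M f
    rw [hh, natDegree_mul hf0 hne] at this
    omega
  rw [natDegree_eq_zero] at hdeg
  obtain ⟨u, rfl⟩ := hdeg
  exact ⟨u, by simpa using hne, by rw [hh, mul_comm], hh'⟩

theorem SemiInvariant.aeval_eq_zero {K : Type*} [Field K] [Algebra F K] {N : ℕ} {p : F[X]}
    (h : SemiInvariant N p) (hp : p.natDegree ≤ N) {t : PGL(2, F)} {z w : K}
    (hz : z ∉ Set.range (algebraMap F K)) (ht : t • (z : OnePoint K) = (w : OnePoint K))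
    (h0 : aeval z p = 0) : aeval w p = 0 := by
  obtain ⟨M, rfl⟩ := Matrix.ProjGenLinGroup.mk_surjective t
  rw [mk_smul_eq_moebius M hz, OnePoint.coe_eq_coe] at ht
  obtain ⟨u, -, hu⟩ := h M
  have h1 := aeval_homSubst M hp (denom_ne_zero M hz)
  rw [hu, map_mul, h0, mul_zero, ht, eq_comm, mul_eq_zero] at h1
  exact h1.resolve_left (pow_ne_zero _ (denom_ne_zero M hz))

theorem SemiInvariant.exists_comp_eq {N : ℕ} {p : F[X]} (h : SemiInvariant N p)
    (hp : p.natDegree ≤ N) {a : F} (ha : a ≠ 0) (b : F) :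
    ∃ u : F, u ≠ 0 ∧ p.comp (C a * X + C b) = C u * p := by
  obtain ⟨u, hu, h1⟩ := h (Matrix.GeneralLinearGroup.mkOfDetNeZero !![a, b; 0, 1] (by simpa))
  refine ⟨u, hu, ?_⟩
  rw [← h1, homSubst, comp, eval₂_eq_sum_range' _ (Nat.lt_succ_of_le hp)]
  simp [Matrix.GeneralLinearGroup.mkOfDetNeZero]

/-- The affine substitution changes `p` by a unit and turns `X - (a z + b)` into a multiple of `X -
z`. -/
theorem SemiInvariant.rootMultiplicity_affine_le {K : Type*} [Field K] [Algebra F K] {N : ℕ}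
    {p : F[X]} (h : SemiInvariant N p) (hp : p.natDegree ≤ N) (hp0 : p ≠ 0) {a : F} (ha : a ≠ 0)
    (b : F) (z : K) :
    (p.map (algebraMap F K)).rootMultiplicity (algebraMap F K a * z + algebraMap F K b) ≤
      (p.map (algebraMap F K)).rootMultiplicity z := by
  have hm0 : p.map (algebraMap F K) ≠ 0 := (Polynomial.map_ne_zero_iff (algebraMap F K).injective).mpr hp0
  obtain ⟨u, hu, hcomp⟩ := h.exists_comp_eq hp ha b
  rw [le_rootMultiplicity_iff hm0]
  obtain ⟨r, hr⟩ := pow_rootMultiplicity_dvd (p.map (algebraMap F K))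
    (algebraMap F K a * z + algebraMap F K b)
  set n := (p.map (algebraMap F K)).rootMultiplicity (algebraMap F K a * z + algebraMap F K b)
  have h1 := congrArg (Polynomial.map (algebraMap F K)) hcomp
  rw [Polynomial.map_comp, hr] at h1
  simp only [mul_comp, pow_comp, sub_comp, X_comp, C_comp, Polynomial.map_add,
    Polynomial.map_mul, Polynomial.map_C, Polynomial.map_X] at h1
  rw [show C (algebraMap F K a) * X + C (algebraMap F K b) -
      C (algebraMap F K a * z + algebraMap F K b) = C (algebraMap F K a) * (X - C z) by
    simp only [map_add, map_mul]; ring, mul_pow] at h1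
  have hu' : IsUnit (C (algebraMap F K u)) := by
    rw [isUnit_C, isUnit_iff_ne_zero]; simpa using hu
  rw [← hu'.dvd_mul_left, ← h1, mul_assoc]
  exact (dvd_mul_right _ _).mul_left _

theorem SemiInvariant.rootMultiplicity_affine {K : Type*} [Field K] [Algebra F K] {N : ℕ}
    {p : F[X]} (h : SemiInvariant N p) (hp : p.natDegree ≤ N) (hp0 : p ≠ 0) {a : F} (ha : a ≠ 0)
    (b : F) (z : K) :
    (p.map (algebraMap F K)).rootMultiplicity (algebraMap F K a * z + algebraMap F K b) =
      (p.map (algebraMap F K)).rootMultiplicity z := by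
  refine le_antisymm (h.rootMultiplicity_affine_le hp hp0 ha b z) ?_
  have h1 := h.rootMultiplicity_affine_le hp hp0 (inv_ne_zero ha) (-(b / a))
    (algebraMap F K a * z + algebraMap F K b)
  have ha' : algebraMap F K a ≠ 0 := by simpa using ha
  have e : algebraMap F K a⁻¹ * (algebraMap F K a * z + algebraMap F K b) +
      algebraMap F K (-(b / a)) = z := by
    simp only [map_inv₀, map_neg, map_div₀]
    field_simp
    ring
  rwa [e] at h1

/-- The swap `x ↦ 1 / x` reverses the coefficients up to a scalar, exchanging the order at `0` with
the order `N - deg p` at `∞`. -/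
theorem SemiInvariant.rootMultiplicity_zero {N : ℕ} {p : F[X]} (h : SemiInvariant N p)
    (hp : p.natDegree ≤ N) (hp0 : p ≠ 0) : p.rootMultiplicity 0 = N - p.natDegree := by
  obtain ⟨u, hu, h1⟩ := h (Matrix.GeneralLinearGroup.mkOfDetNeZero !![0, 1; 1, 0] (by simp))
  have hcoeff : ∀ i ≤ N, u * p.coeff (N - i) = p.coeff i := by
    intro i hi
    rw [← coeff_C_mul, ← h1, homSubst, finsetSum_coeff, Finset.sum_eq_single i]
    · simp [Matrix.GeneralLinearGroup.mkOfDetNeZero]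
    · intro j hj hji
      have hj' : j ≤ N := Nat.lt_succ_iff.mp (Finset.mem_range.mp hj)
      simp [Matrix.GeneralLinearGroup.mkOfDetNeZero, coeff_X_pow]
      omega
    · intro hi'
      exact absurd (Finset.mem_range.mpr (Nat.lt_succ_of_le hi)) hi'
  rw [rootMultiplicity_eq_natTrailingDegree']
  refine le_antisymm (natTrailingDegree_le_of_ne_zero ?_) (le_natTrailingDegree hp0 ?_)
  · intro h0
    have := hcoeff p.natDegree hp
    rw [h0, mul_zero] at this
    exact hp0 (leadingCoeff_eq_zero.mp this.symm)
  · intro i hi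
    rw [← hcoeff i (by omega), coeff_eq_zero_of_natDegree_lt (by omega), mul_zero]

theorem SemiInvariant.rootMultiplicity_algebraMap {K : Type*} [Field K] [Algebra F K] {N : ℕ}
    {p : F[X]} (h : SemiInvariant N p) (hp : p.natDegree ≤ N) (hp0 : p ≠ 0) (x : F) :
    (p.map (algebraMap F K)).rootMultiplicity (algebraMap F K x) = N - p.natDegree := by
  have h1 := h.rootMultiplicity_affine (K := K) hp hp0 one_ne_zero x 0
  rw [mul_zero, zero_add] at h1
  rw [h1, ← h.rootMultiplicity_zero hp hp0, eq_rootMultiplicity_map (algebraMap F K).injective,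
    map_zero]

end SemiInvariant

/-! ### Fibres as root sets -/

section Value

variable {F K : Type*} [Field F] [Field K] [Algebra F K]

/-- The pair `(f, g)` is the reduced fraction up to a unit. At a zero of `g` both sides fail, since
`f` does not vanish there. -/
theorem value_eq_coe_iff {f g : F[X]} (hfg : IsCoprime f g) (hg : g ≠ 0) {Φ : RatFunc F}
    (hΦ : Φ = algebraMap F[X] (RatFunc F) f / algebraMap F[X] (RatFunc F) g) (z : K) (x : F) :
    value Φ z = ((algebraMap F K x : K) : OnePoint K) ↔ aeval z (f - C x * g) = 0 := by
  have hcross := mul_denom_eq_num_mul hg hΦ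
  obtain ⟨k, hk⟩ : g ∣ Φ.denom := hfg.symm.dvd_of_dvd_mul_left ⟨_, hcross.trans (mul_comm _ _)⟩
  have hk' : Φ.num = f * k := by
    apply mul_right_cancel₀ hg
    rw [← hcross, hk]
    ring
  have hcop := RatFunc.isCoprime_num_denom Φ
  have hku : IsUnit k := by
    rw [hk', hk] at hcop
    exact hcop.isUnit_of_dvd' (dvd_mul_left _ _) (dvd_mul_left _ _)
  have hkz : aeval z k ≠ 0 := (hku.map (aeval z)).ne_zero
  have hfg0 : ¬ (aeval z f = 0 ∧ aeval z g = 0) := by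
    rintro ⟨h1, h2⟩
    obtain ⟨a, b, hab⟩ := hfg
    have := congrArg (aeval z) hab
    simp [h1, h2] at this
  rw [value, hk, hk', map_mul, map_mul, map_sub, map_mul, aeval_C, sub_eq_zero]
  by_cases hgz : aeval z g = 0
  · simp only [hgz, zero_mul, if_true, mul_zero]
    simp only [OnePoint.infty_ne_coe, false_iff]
    exact fun h => hfg0 ⟨h, hgz⟩
  · rw [if_neg (mul_ne_zero hgz hkz), OnePoint.coe_eq_coe, mul_div_mul_right _ _ hkz,
      div_eq_iff hgz]

end Value

/-! ### Root counting -/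

section Fibres

variable {F K : Type*} [Field F] [Field K] [Algebra F K] {N : ℕ} {p : F[X]}

theorem mem_roots_map_iff (hp0 : p ≠ 0) {z : K} :
    z ∈ (p.map (algebraMap F K)).roots ↔ aeval z p = 0 := by
  rw [mem_roots ((Polynomial.map_ne_zero_iff (algebraMap F K).injective).mpr hp0), IsRoot,
    eval_map_algebraMap]

theorem rootMultiplicity_map_pos (hp0 : p ≠ 0) {z : K} :
    0 < (p.map (algebraMap F K)).rootMultiplicity z ↔ aeval z p = 0 := by
  rw [rootMultiplicity_pos ((Polynomial.map_ne_zero_iff (algebraMap F K).injective).mpr hp0),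
    IsRoot, eval_map_algebraMap]

theorem inRegularOrbit_of_smul_eq {t : PGL(2, F)} {z w : K}
    (ht : t • (z : OnePoint K) = (w : OnePoint K))
    (hreg : InRegularOrbit F (z : OnePoint K)) : InRegularOrbit F (w : OnePoint K) := by
  rw [InRegularOrbit, ← ht, MulAction.orbit_smul]
  exact hreg

theorem natDegree_eq_sum_roots [IsAlgClosed K] [DecidableEq K] :
    p.natDegree = ∑ w ∈ (p.map (algebraMap F K)).roots.toFinset,
      (p.map (algebraMap F K)).rootMultiplicity w := by
  rw [← natDegree_map (algebraMap F K), (IsAlgClosed.splits _).natDegree_eq_card_roots,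
    ← Multiset.toFinset_sum_count_eq]
  simp only [count_roots]

theorem SemiInvariant.not_mem_range_of_root (h : SemiInvariant N p) (hp : p.natDegree = N)
    (hp0 : p ≠ 0) {z : K} (h0 : aeval z p = 0) : z ∉ Set.range (algebraMap F K) := by
  rintro ⟨x, rfl⟩
  have h1 := h.rootMultiplicity_algebraMap (K := K) hp.le hp0 x
  rw [hp, Nat.sub_self] at h1
  have h2 := (rootMultiplicity_map_pos hp0).mpr h0
  omega

variable [Finite F]

-- A trivial stabilizer makes the orbit map injective, so the orbit supplies `|G|` distinct roots.
open Classical in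
theorem SemiInvariant.exists_image_subset_roots (h : SemiInvariant N p) (hp : p.natDegree ≤ N)
    (hp0 : p ≠ 0) {z : K} (hz : z ∉ Set.range (algebraMap F K))
    (hreg : InRegularOrbit F (z : OnePoint K)) (h0 : aeval z p = 0) :
    ∃ R : Finset K, R.card = Nat.card PGL(2, F) ∧
      R ⊆ (p.map (algebraMap F K)).roots.toFinset ∧
      ∀ w ∈ R, ∃ t : PGL(2, F), t • (z : OnePoint K) = (w : OnePoint K) := by
  have := Fintype.ofFinite PGL(2, F)
  choose φ hφ1 hφ2 using fun t : PGL(2, F) => exists_smul_eq_coe t hz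
  rw [inRegularOrbit_iff] at hreg
  have hinj : Function.Injective φ := by
    intro t t' htt
    have h1 : (t'⁻¹ * t) • (z : OnePoint K) = (z : OnePoint K) := by
      rw [mul_smul, hφ2, htt, ← hφ2, inv_smul_smul]
    exact (inv_mul_eq_one.mp (hreg _ h1)).symm
  refine ⟨Finset.univ.image φ, ?_, ?_, ?_⟩
  · rw [Finset.card_image_of_injective _ hinj, Finset.card_univ, Nat.card_eq_fintype_card]
  · intro w hw
    obtain ⟨t, -, rfl⟩ := Finset.mem_image.mp hw
    rw [Multiset.mem_toFinset, mem_roots_map_iff hp0]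
    exact h.aeval_eq_zero hp hz (hφ2 t) h0
  · intro w hw
    obtain ⟨t, -, rfl⟩ := Finset.mem_image.mp hw
    exact ⟨t, hφ2 t⟩

theorem SemiInvariant.card_le_natDegree (h : SemiInvariant N p) (hp : p.natDegree ≤ N)
    (hp0 : p ≠ 0) {z : K} (hz : z ∉ Set.range (algebraMap F K))
    (hreg : InRegularOrbit F (z : OnePoint K)) (h0 : aeval z p = 0) :
    Nat.card PGL(2, F) ≤ p.natDegree := by
  classical
  obtain ⟨R, hR, hsub, -⟩ := h.exists_image_subset_roots hp hp0 hz hreg h0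
  calc Nat.card PGL(2, F) = R.card := hR.symm
    _ ≤ _ := Finset.card_le_card hsub
    _ ≤ _ := Multiset.toFinset_card_le _
    _ ≤ _ := card_roots' _
    _ = _ := natDegree_map _

/-- A semi-invariant polynomial of degree `|G|` with a root in a regular orbit vanishes exactly on
this orbit, with simple roots. -/
theorem SemiInvariant.root_of_regular (h : SemiInvariant N p) (hN : N = Nat.card PGL(2, F))
    (hp : p.natDegree = N) {z : K} (hz : z ∉ Set.range (algebraMap F K))
    (hreg : InRegularOrbit F (z : OnePoint K)) (h0 : aeval z p = 0) {w : K}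
    (hw : aeval w p = 0) :
    (∃ t : PGL(2, F), t • (z : OnePoint K) = (w : OnePoint K)) ∧
      (p.map (algebraMap F K)).rootMultiplicity w = 1 := by
  classical
  have hpos : 0 < Nat.card PGL(2, F) := Nat.card_pos
  have hp0 : p ≠ 0 := by rintro rfl; simp at hp; omega
  obtain ⟨R, hR, hsub, hR'⟩ := h.exists_image_subset_roots hp.le hp0 hz hreg h0
  have h1 := Finset.card_le_card hsub
  have h2 := Multiset.toFinset_card_le (p.map (algebraMap F K)).roots
  have h3 := card_roots' (p.map (algebraMap F K))
  rw [natDegree_map] at h3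
  have hmem : w ∈ (p.map (algebraMap F K)).roots := (mem_roots_map_iff hp0).mpr hw
  -- Degree `|G|` leaves room only for `R`, and for no repeated root.
  constructor
  · apply hR'
    rw [Finset.eq_of_subset_of_card_le hsub (by omega), Multiset.mem_toFinset]
    exact hmem
  · rw [← count_roots]
    exact Multiset.count_eq_one_of_mem
      (Multiset.toFinset_card_eq_card_iff_nodup.mp (by omega)) hmem

theorem SemiInvariant.rootMultiplicity_eq_of_quadratic (h : SemiInvariant N p)
    (hp : p.natDegree ≤ N) (hp0 : p ≠ 0) {z w : K} (hz : z ∉ Set.range (algebraMap F K))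
    (hz2 : frob F K (frob F K z) = z) (hw : w ∉ Set.range (algebraMap F K))
    (hw2 : frob F K (frob F K w) = w) :
    (p.map (algebraMap F K)).rootMultiplicity w = (p.map (algebraMap F K)).rootMultiplicity z := by
  obtain ⟨a, b, ha, rfl⟩ := exists_affine hz hw hz2 hw2
  exact h.rootMultiplicity_affine hp hp0 ha b z

/-- The roots outside `F` of a semi-invariant polynomial with a root in the quadratic
extension and none outside of it. -/
theorem SemiInvariant.card_filter_roots (h : SemiInvariant N p) (hp : p.natDegree ≤ N)
    (hp0 : p ≠ 0) {z : K} (hz : z ∉ Set.range (algebraMap F K))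
    (hz2 : frob F K (frob F K z) = z) (h0 : aeval z p = 0)
    (hroots : ∀ w, w ∉ Set.range (algebraMap F K) → aeval w p = 0 → frob F K (frob F K w) = w)
    [DecidableEq K] [DecidablePred (· ∈ Set.range (algebraMap F K))] :
    ((p.map (algebraMap F K)).roots.toFinset.filter
      fun w => ¬ w ∈ Set.range (algebraMap F K)).card = (Nat.card F - 1) * Nat.card F := by
  rw [← card_quadratic_points hz hz2]
  symm
  apply Nat.subtype_card
  intro w
  rw [Finset.mem_filter, Multiset.mem_toFinset, mem_roots_map_iff hp0]
  constructor
  · rintro ⟨h1, h2⟩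
    exact ⟨h2, hroots w h2 h1⟩
  · rintro ⟨h1, h2⟩
    refine ⟨?_, h1⟩
    rw [← rootMultiplicity_map_pos hp0, h.rootMultiplicity_eq_of_quadratic hp hp0 hz hz2 h1 h2]
    exact (rootMultiplicity_map_pos hp0).mpr h0

/-- A semi-invariant polynomial of degree `|G|` with a root in the quadratic extension has all its
roots there, with multiplicity `|F| + 1`. -/
theorem SemiInvariant.root_of_quadratic [IsAlgClosed K] (h : SemiInvariant N p)
    (hN : N = Nat.card PGL(2, F)) (hp : p.natDegree = N) {z : K}
    (hz2 : frob F K (frob F K z) = z) (h0 : aeval z p = 0) {w : K} (hw : aeval w p = 0) :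
    frob F K (frob F K w) = w ∧
      (p.map (algebraMap F K)).rootMultiplicity w = Nat.card F + 1 := by
  classical
  have hpos : 0 < Nat.card PGL(2, F) := Nat.card_pos
  have hp0 : p ≠ 0 := by rintro rfl; simp at hp; omega
  have hz := h.not_mem_range_of_root hp hp0 h0
  -- A root with a regular orbit would have `z` in that orbit.
  have hroots : ∀ w : K, aeval w p = 0 → frob F K (frob F K w) = w := by
    intro w hw
    have hwr := h.not_mem_range_of_root hp hp0 hw
    rw [← not_inRegularOrbit_iff hwr]
    intro hreg
    obtain ⟨⟨t, ht⟩, -⟩ := h.root_of_regular hN hp hwr hreg hw h0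
    exact (not_inRegularOrbit_iff hz).mpr hz2 (inRegularOrbit_of_smul_eq ht hreg)
  refine ⟨hroots w hw, ?_⟩
  have hmult : ∀ w' ∈ (p.map (algebraMap F K)).roots.toFinset,
      (p.map (algebraMap F K)).rootMultiplicity w' =
        (p.map (algebraMap F K)).rootMultiplicity w := by
    intro w' hw'
    rw [Multiset.mem_toFinset, mem_roots_map_iff hp0] at hw'
    exact h.rootMultiplicity_eq_of_quadratic hp.le hp0 (h.not_mem_range_of_root hp hp0 hw)
      (hroots w hw) (h.not_mem_range_of_root hp hp0 hw') (hroots w' hw')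
  have hcard := h.card_filter_roots hp.le hp0 hz hz2 h0 fun w _ hw => hroots w hw
  rw [Finset.filter_true_of_mem fun w' hw' => h.not_mem_range_of_root hp hp0
    ((mem_roots_map_iff hp0).mp (Multiset.mem_toFinset.mp hw'))] at hcard
  -- There are `q² - q` roots of equal multiplicity, adding up to `q³ - q`.
  have hsum := natDegree_eq_sum_roots (K := K) (p := p)
  rw [Finset.sum_congr rfl hmult, Finset.sum_const, hcard, smul_eq_mul, hp, hN,
    card_PGL_two] at hsum
  have hq : 1 < Nat.card F := Finite.one_lt_card
  obtain ⟨m, hm⟩ : ∃ m, Nat.card F = m + 1 := ⟨Nat.card F - 1, by omega⟩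
  rw [hm] at hsum ⊢ hq
  have e3 : (m + 1) ^ 3 - (m + 1) = m * (m + 1) * (m + 1 + 1) := by
    rw [Nat.sub_eq_iff_eq_add (Nat.le_self_pow (by norm_num) _)]; ring
  rw [e3, Nat.add_sub_cancel] at hsum
  exact (Nat.eq_of_mul_eq_mul_left (Nat.mul_pos (by omega) (by omega)) hsum).symm

/-- A semi-invariant polynomial of degree less than `|G|` has all its roots in `F`. -/
theorem SemiInvariant.aeval_ne_zero [IsAlgClosed K] (h : SemiInvariant N p)
    (hN : N = Nat.card PGL(2, F)) (hp : p.natDegree < N) (hp0 : p ≠ 0) (heven : Even (Nat.card F))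
    {z : K} (hz : z ∉ Set.range (algebraMap F K)) : aeval z p ≠ 0 := by
  classical
  intro h0
  have hroots : ∀ w : K, w ∉ Set.range (algebraMap F K) → aeval w p = 0 →
      frob F K (frob F K w) = w := by
    intro w hwr hw
    rw [← not_inRegularOrbit_iff hwr]
    intro hreg
    have := h.card_le_natDegree hp.le hp0 hwr hreg hw
    omega
  have hz2 := hroots z hz h0
  have hcard := h.card_filter_roots hp.le hp0 hz hz2 h0 hroots
  -- Here `N - deg p > 0`, so every element of `F` is a root.
  have hcard' : ((p.map (algebraMap F K)).roots.toFinset.filter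
      fun w => w ∈ Set.range (algebraMap F K)).card = Nat.card F := by
    rw [Nat.card_congr (Equiv.ofInjective _ (algebraMap F K).injective)]
    symm
    apply Nat.subtype_card
    intro w
    rw [Finset.mem_filter, Multiset.mem_toFinset, mem_roots_map_iff hp0, and_iff_right_iff_imp]
    rintro ⟨x, rfl⟩
    rw [← rootMultiplicity_map_pos hp0, h.rootMultiplicity_algebraMap hp.le hp0]
    omega
  have hsum := natDegree_eq_sum_roots (K := K) (p := p)
  rw [← Finset.sum_filter_add_sum_filter_not _ (· ∈ Set.range (algebraMap F K)),
    Finset.sum_congr rfl (g := fun _ => N - p.natDegree) (by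
      intro w hw
      obtain ⟨x, rfl⟩ := (Finset.mem_filter.mp hw).2
      exact h.rootMultiplicity_algebraMap hp.le hp0 x),
    Finset.sum_congr (s₁ := Finset.filter (fun w => ¬ w ∈ Set.range (algebraMap F K)) _) rfl
      (g := fun _ => (p.map (algebraMap F K)).rootMultiplicity z) (by
      intro w hw
      obtain ⟨hw1, hw2⟩ := Finset.mem_filter.mp hw
      rw [Multiset.mem_toFinset, mem_roots_map_iff hp0] at hw1
      exact h.rootMultiplicity_eq_of_quadratic hp.le hp0 hz hz2 hw2 (hroots w hw2 hw1)),
    Finset.sum_const, Finset.sum_const, hcard, hcard', smul_eq_mul, smul_eq_mul] at hsum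
  have he := (rootMultiplicity_map_pos hp0).mpr h0
  obtain ⟨e, he'⟩ : ∃ e, e = (p.map (algebraMap F K)).rootMultiplicity z := ⟨_, rfl⟩
  rw [← he'] at hsum he
  have hq : 1 < Nat.card F := Finite.one_lt_card
  rw [card_PGL_two] at hN
  obtain ⟨m, hm⟩ : ∃ m, Nat.card F = m + 1 := ⟨Nat.card F - 1, by omega⟩
  rw [hm] at hsum hN heven hq
  have e3 : (m + 1) ^ 3 - (m + 1) = m * (m + 1) * (m + 1 + 1) := by
    rw [Nat.sub_eq_iff_eq_add (Nat.le_self_pow (by norm_num) _)]; ring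
  rw [e3] at hN
  rw [Nat.add_sub_cancel] at hsum
  obtain ⟨d, hd, hd0⟩ : ∃ d, N = p.natDegree + d ∧ 0 < d := ⟨N - p.natDegree, by omega, by omega⟩
  rw [hd, Nat.add_sub_cancel_left] at hsum
  -- With `q = m + 1`: multiplicity `d` at the `q + 1` points of `P¹(F)` and `e` at the quadratic
  -- points exhaust the degree `q³ - q`.
  have key : (m + 2) * d + m * (m + 1) * e = m * (m + 1) * (m + 2) := by
    rw [show m + 2 = m + 1 + 1 from rfl, ← hN, hd, hsum]
    ring
  have hdvd : m + 2 ∣ m * (m + 1) * e :=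
    (Nat.dvd_add_right (dvd_mul_right _ d)).mp (key ▸ dvd_mul_left _ _)
  have hc1 : Nat.Coprime (m + 2) (m + 1) := by
    simp [show m + 2 = (m + 1) + 1 from rfl]
  -- For odd `q`, `q + 1` and `q - 1` would share the factor `2`.
  have hc2 : Nat.Coprime (m + 2) m := by
    have : Odd m := by
      rcases heven with ⟨k, hk⟩
      exact ⟨k - 1, by omega⟩
    rw [Nat.coprime_comm]
    simpa using this.coprime_two_right
  -- Now `e ≥ q + 1`, so the quadratic points alone fill the degree and `d > 0` is impossible.
  have hdvd' : m + 2 ∣ e := (hc2.mul_right hc1).dvd_of_dvd_mul_left hdvd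
  obtain ⟨k, rfl⟩ := hdvd'
  have hk : 0 < k := Nat.pos_of_mul_pos_left he
  have h1 : m * (m + 1) * (m + 2) * 1 ≤ m * (m + 1) * (m + 2) * k := Nat.mul_le_mul_left _ hk
  have h2 : 0 < (m + 2) * d := Nat.mul_pos (by omega) hd0
  rw [← mul_assoc] at key
  omega

end Fibres

/-! ### From root data to a factorization over `F` -/

section Factorization

variable {F K : Type*} [Field F] [Finite F] [Field K] [Algebra F K] [IsAlgClosed K]

open UniqueFactorizationMonoid in
/-- A polynomial all of whose roots have multiplicity `e` and degree `r`. -/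
theorem exists_factorization {h : F[X]} (h0 : h ≠ 0) {e r : ℕ}
    (H : ∀ z : K, aeval z h = 0 →
      (h.map (algebraMap F K)).rootMultiplicity z = e ∧ (minpoly F z).natDegree = r) :
    ∃ S : Finset F[X], S.card * r * e = h.natDegree ∧
      (∀ p ∈ S, p.Monic ∧ Irreducible p ∧ p.natDegree = r) ∧
      h = C h.leadingCoeff * ∏ p ∈ S, p ^ e := by
  classical
  set S := (normalizedFactors h).toFinset with hS
  have hirr : ∀ p ∈ S, Irreducible p := fun p hp =>
    irreducible_of_normalized_factor p (Multiset.mem_toFinset.mp hp)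
  have hdvd : ∀ p ∈ S, p ∣ h := fun p hp =>
    dvd_of_mem_normalizedFactors (Multiset.mem_toFinset.mp hp)
  have hmonic : ∀ p ∈ S, p.Monic := fun p hp =>
    (normalize_eq_self_iff_monic (hirr p hp).ne_zero).mp
      (normalize_normalized_factor p (Multiset.mem_toFinset.mp hp))
  have hdeg : ∀ p ∈ S, p.natDegree = r := by
    intro p hp
    obtain ⟨z, hz⟩ := IsAlgClosed.exists_aeval_eq_zero K p
      (degree_pos_of_irreducible (hirr p hp)).ne'
    rw [minpoly.eq_of_irreducible_of_monic (hirr p hp) hz (hmonic p hp)]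
    exact (H z (aeval_eq_zero_of_dvd_aeval_eq_zero (hdvd p hp) hz)).2
  set m := ∏ p ∈ S, p with hm
  have hmm : m.Monic := monic_prod_of_monic _ _ hmonic
  -- Distinct monic irreducibles over a perfect field have a product with simple roots, so over `K`
  -- it remains to compare `h` with `m ^ e`.
  have hsep : m.Separable := by
    rw [hm]
    refine separable_prod' ?_ fun p hp => PerfectField.separable_of_irreducible (hirr p hp)
    intro p hp p' hp' hne
    rw [(hirr p hp).coprime_iff_not_dvd]
    intro hd
    exact hne (eq_of_monic_of_associated (hmonic p hp) (hmonic p' hp')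
      ((hirr p hp).associated_of_dvd (hirr p' hp') hd))
  have hroot : ∀ z : K, aeval z m = 0 ↔ aeval z h = 0 := by
    intro z
    rw [hm, map_prod, Finset.prod_eq_zero_iff]
    constructor
    · rintro ⟨p, hp, hz⟩
      exact aeval_eq_zero_of_dvd_aeval_eq_zero (hdvd p hp) hz
    · intro hz
      have hint : IsIntegral F z := isAlgebraic_iff_isIntegral.mp ⟨h, h0, hz⟩
      obtain ⟨p, hp, hassoc⟩ := exists_mem_normalizedFactors_of_dvd h0
        (minpoly.irreducible hint) (minpoly.dvd F z hz)
      exact ⟨p, Multiset.mem_toFinset.mpr hp,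
        aeval_eq_zero_of_dvd_aeval_eq_zero hassoc.dvd (minpoly.aeval F z)⟩
  have hsets : (h.map (algebraMap F K)).roots.toFinset =
      (m.map (algebraMap F K)).roots.toFinset := by
    ext z
    rw [Multiset.mem_toFinset, Multiset.mem_toFinset, mem_roots_map_iff h0,
      mem_roots_map_iff hmm.ne_zero, hroot]
  have hmK : m.map (algebraMap F K) =
      ∏ z ∈ (m.map (algebraMap F K)).roots.toFinset, (X - C z) := by
    conv_lhs => rw [(IsAlgClosed.splits (m.map (algebraMap F K))).eq_prod_roots_of_monic (hmm.map _)]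
    rw [Finset.prod, Multiset.toFinset_val, Multiset.dedup_eq_self.mpr (nodup_roots hsep.map)]
  have hfac : h = C h.leadingCoeff * ∏ p ∈ S, p ^ e := by
    apply Polynomial.map_injective _ (algebraMap F K).injective
    rw [Finset.prod_pow, ← hm, Polynomial.map_mul, Polynomial.map_pow, hmK, ← Finset.prod_pow,
      ← hsets, Polynomial.map_C, ← leadingCoeff_map]
    conv_lhs => rw [(IsAlgClosed.splits (h.map (algebraMap F K))).eq_prod_roots,
      Finset.prod_multiset_map_count]
    congr 1
    refine Finset.prod_congr rfl fun z hz => ?_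
    rw [count_roots, (H z ((mem_roots_map_iff h0).mp (Multiset.mem_toFinset.mp hz))).1]
  refine ⟨S, ?_, fun p hp => ⟨hmonic p hp, hirr p hp, hdeg p hp⟩, hfac⟩
  conv_rhs => rw [hfac]
  rw [natDegree_C_mul (leadingCoeff_ne_zero.mpr h0), natDegree_prod_of_monic _ _
    fun p hp => (hmonic p hp).pow e, Finset.sum_congr rfl (g := fun _ => e * r)
    (fun p hp => by rw [natDegree_pow, hdeg p hp]), Finset.sum_const, smul_eq_mul]
  ring

end Factorization

/-! ### Conjugacy classes and points where they act as Frobenius -/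

section Classes

variable {F K : Type*} [Field F] [Finite F] [Field K] [Algebra F K]

/-- The element swaps `z` and `z^q`; subtracting the two equations leaves `(a + d)(z - z^q) = 0`. -/
theorem add_eq_zero_of_smul_eq_frob {a b c d : F} {h : a * d - b * c ≠ 0} {z : K}
    (hz : z ∉ Set.range (algebraMap F K)) (hz2 : frob F K (frob F K z) = z)
    (hs : ofEntries a b c d h • (z : OnePoint K) = ((frob F K z : K) : OnePoint K)) :
    a + d = 0 := by
  rw [ofEntries_smul_eq_coe_iff h hz] at hs
  have h1 := congrArg (frob F K) hs
  simp only [map_add, map_mul, AlgHom.commutes, hz2] at h1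
  have hne : z - frob F K z ≠ 0 := fun h => hz (frob_eq_self_iff.mp (sub_eq_zero.mp h).symm)
  apply (algebraMap F K).injective
  rw [map_zero, map_add]
  apply mul_right_cancel₀ hne
  linear_combination hs - h1

/-- In characteristic two, the elements acting as the Frobenius map on some point of the quadratic
extension form a single conjugacy class (the involutions). -/
theorem isConj_of_quadratic [IsAlgClosed K] (hF : ringChar F = 2) {s s' : PGL(2, F)} {z w : K}
    (hz : z ∉ Set.range (algebraMap F K)) (hz2 : frob F K (frob F K z) = z)
    (hw : w ∉ Set.range (algebraMap F K)) (hw2 : frob F K (frob F K w) = w)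
    (hs : s • (z : OnePoint K) = ((frob F K z : K) : OnePoint K))
    (hs' : s' • (w : OnePoint K) = ((frob F K w : K) : OnePoint K)) : IsConj s s' := by
  obtain ⟨a, b, c, d, h, rfl⟩ := exists_ofEntries s
  obtain ⟨a', b', c', d', h', rfl⟩ := exists_ofEntries s'
  have ht := add_eq_zero_of_smul_eq_frob hz hz2 hs
  have ht' := add_eq_zero_of_smul_eq_frob hw hw2 hs'
  -- Every element of `F` is a square, so a scalar equalizes the determinants; both traces are
  -- already zero.
  obtain ⟨k, hk⟩ := FiniteField.isSquare_of_char_two hF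
    ((a * d - b * c) / (a' * d' - b' * c'))
  have hk0 : k ≠ 0 := by
    rintro rfl
    rw [mul_zero] at hk
    exact div_ne_zero h h' hk
  have hdet : a * d - b * c = k * a' * (k * d') - k * b' * (k * c') := by
    rw [div_eq_iff h'] at hk
    rw [hk]
    ring
  rw [← ofEntries_scale h' hk0 (hdet ▸ h)] at hs' ⊢
  obtain ⟨t, -, ht2⟩ := exists_smul_eq_and_conj h (hdet ▸ h)
    (by linear_combination ht - k * ht') hdet hz hw hs hs'
  exact isConj_iff.mpr ⟨t, ht2⟩

/-- Both `t s` and `s' t` send `z` to `w^q`, so they coincide. -/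
theorem isConj_of_regular {s s' t : PGL(2, F)} {z w : K}
    (hz : z ∉ Set.range (algebraMap F K)) (hreg : InRegularOrbit F (z : OnePoint K))
    (hs : s • (z : OnePoint K) = ((frob F K z : K) : OnePoint K))
    (hs' : s' • (w : OnePoint K) = ((frob F K w : K) : OnePoint K))
    (ht : t • (z : OnePoint K) = (w : OnePoint K)) : IsConj s s' := by
  have h1 : t • s • (z : OnePoint K) = s' • t • (z : OnePoint K) := by
    rw [hs, ht, hs', smul_frob hz ht]
  have h2 : ((s' * t)⁻¹ * (t * s)) • (z : OnePoint K) = (z : OnePoint K) := by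
    rw [mul_smul, mul_smul, h1, ← mul_smul s', inv_smul_smul]
  have h3 := inv_mul_eq_one.mp (inRegularOrbit_iff.mp hreg _ h2)
  exact isConj_iff.mpr ⟨t, by rw [← h3, mul_inv_cancel_right]⟩

/-- Every nontrivial element of `PGL(2, F)` acts as the Frobenius map on some point. -/
theorem exists_smul_eq_frob [IsAlgClosed K] {s : PGL(2, F)} (hs : s ≠ 1) :
    ∃ z : K, z ∉ Set.range (algebraMap F K) ∧
      s • (z : OnePoint K) = ((frob F K z : K) : OnePoint K) := by
  classical
  obtain ⟨a, b, c, d, h, rfl⟩ := exists_ofEntries s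
  rw [ne_eq, ofEntries_eq_one_iff] at hs
  have hq : 1 < Nat.card F := Finite.one_lt_card
  have hqF : ((Nat.card F : ℕ) : F) = 0 := by
    let := Fintype.ofFinite F
    rw [Nat.card_eq_fintype_card, FiniteField.cast_card_eq_zero]
  obtain ⟨q, hqdef⟩ : ∃ q, q = Nat.card F := ⟨_, rfl⟩
  rw [← hqdef] at hq hqF
  -- The roots of `P` solve `a z + b = z^q (c z + d)`; those in `F` satisfy `z^q = z` and are roots
  -- of `Q`.
  set P : F[X] := C c * X ^ (q + 1) + C d * X ^ q - C a * X - C b with hP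
  set Q : F[X] := C c * X ^ 2 + C (d - a) * X + C (-b) with hQ
  have hPd : derivative P = C c * X ^ q - C a := by
    simp [hP, hqF, derivative_X_pow]
  have hsep : P.Separable := by
    -- Bézout: `c P - (c X + d) P' = a d - b c`.
    refine ⟨C (c / (a * d - b * c)), -(C (1 / (a * d - b * c)) * (C c * X + C d)), ?_⟩
    have e1 : C (a * d - b * c) * C (1 / (a * d - b * c)) = (1 : F[X]) := by
      rw [← C_mul, mul_one_div_cancel h, C_1]
    rw [hPd, hP, div_eq_mul_one_div c, C_mul]
    rw [← e1]
    simp only [C_sub, C_mul]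
    ring
  have hQ0 : Q ≠ 0 := by
    intro h0
    have c0 := congrArg (coeff · 0) h0
    have c1 := congrArg (coeff · 1) h0
    have c2 := congrArg (coeff · 2) h0
    simp [hQ, coeff_X, coeff_C] at c0 c1 c2
    exact hs ⟨(sub_eq_zero.mp c1).symm, c0, c2⟩
  have hdeg : Q.natDegree < P.natDegree := by
    by_cases hc : c = 0
    · subst hc
      have hd : d ≠ 0 := by rintro rfl; simp at h
      have h1 : Q.natDegree ≤ 1 := by
        rw [hQ, C_0, zero_mul, zero_add]
        exact natDegree_linear_le
      have h2 : q ≤ P.natDegree := by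
        refine le_natDegree_of_ne_zero ?_
        simp [hP, coeff_X, coeff_C, show q ≠ 0 by omega, show 1 ≠ q by omega, hd]
      omega
    · have h1 : Q.natDegree ≤ 2 := natDegree_quadratic_le
      have h2 : q + 1 ≤ P.natDegree := by
        refine le_natDegree_of_ne_zero ?_
        simp [hP, coeff_C, show q ≠ 0 by omega, hc]
      omega
  have hPz : ∀ z : K, aeval z P = 0 →
      algebraMap F K a * z + algebraMap F K b =
        frob F K z * (algebraMap F K c * z + algebraMap F K d) := by
    intro z hz
    simp only [hP, map_sub, map_add, map_mul, map_pow, aeval_C, aeval_X] at hz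
    rw [frob_apply, ← hqdef]
    linear_combination -hz
  by_contra! hall
  have hsub : P.rootSet K ⊆ algebraMap F K '' (Q.roots.toFinset : Set F) := by
    intro z hz
    have hz0 := hPz z (aeval_eq_zero_of_mem_rootSet hz)
    by_cases hzr : z ∈ Set.range (algebraMap F K)
    · obtain ⟨x, rfl⟩ := hzr
      refine ⟨x, ?_, rfl⟩
      rw [AlgHom.commutes] at hz0
      rw [Finset.mem_coe, Multiset.mem_toFinset, mem_roots hQ0, IsRoot, hQ]
      apply (algebraMap F K).injective
      simp only [eval_add, eval_mul, eval_pow, eval_C, eval_X, eval_sub,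
        eval_neg, map_add, map_sub, map_mul,
        map_pow, map_neg, map_zero]
      linear_combination -hz0
    · exact absurd ((ofEntries_smul_eq_coe_iff h hzr).mpr hz0) (hall z hzr)
  have h1 := Set.ncard_le_ncard hsub ((Finset.finite_toSet _).image _)
  have h2 := Set.ncard_image_le (f := algebraMap F K) (Q.roots.toFinset.finite_toSet)
  rw [Set.ncard_coe_finset] at h2
  have h3 := Multiset.toFinset_card_le Q.roots
  have h4 := card_roots' Q
  have h5 : (P.rootSet K).ncard = P.natDegree := by
    rw [← Nat.card_coe_set_eq, Nat.card_eq_fintype_card,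
      card_rootSet_eq_natDegree hsep (IsAlgClosed.splits _)]
  omega

/-- Since `s^k` and the `k`-th iterate of Frobenius agree at `z`, whose stabilizer is trivial, the
two have the same period. -/
theorem natDegree_minpoly_eq_orderOf {s : PGL(2, F)} {z : K} (hint : IsIntegral F z)
    (hz : z ∉ Set.range (algebraMap F K)) (hreg : InRegularOrbit F (z : OnePoint K))
    (hs : s • (z : OnePoint K) = ((frob F K z : K) : OnePoint K)) :
    (minpoly F z).natDegree = orderOf s := by
  have key : ∀ k, (minpoly F z).natDegree ∣ k ↔ orderOf s ∣ k := by
    intro k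
    rw [natDegree_minpoly_dvd_iff hint, orderOf_dvd_iff_pow_eq_one, ← OnePoint.coe_eq_coe,
      ← pow_smul_eq_frob_iterate hz hs]
    exact ⟨inRegularOrbit_iff.mp hreg _, fun h => by rw [h, one_smul]⟩
  exact Nat.dvd_antisymm ((key _).mpr dvd_rfl) ((key _).mp dvd_rfl)

theorem natDegree_minpoly_eq_two {z : K} (hint : IsIntegral F z)
    (hz : z ∉ Set.range (algebraMap F K)) (hz2 : frob F K (frob F K z) = z) :
    (minpoly F z).natDegree = 2 := by
  have h1 := (natDegree_minpoly_dvd_iff hint 2).mpr hz2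
  refine ((Nat.dvd_prime Nat.prime_two).mp h1).resolve_left fun h => hz ?_
  simpa using minpoly.natDegree_eq_one_iff.mp h

end Classes

/-! ### The structure of one fibre -/

section Fibre

variable {F K : Type*} [Field F] [Finite F] [Field K] [Algebra F K] [IsAlgClosed K] {N : ℕ}
  {p : F[X]}

/-- The roots of a semi-invariant polynomial of degree `|G|` form a single orbit. -/
theorem SemiInvariant.exists_smul_eq (h : SemiInvariant N p) (hN : N = Nat.card PGL(2, F))
    (hp : p.natDegree = N) (hp0 : p ≠ 0) {z w : K} (hz : aeval z p = 0) (hw : aeval w p = 0) :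
    ∃ t : PGL(2, F), t • (z : OnePoint K) = (w : OnePoint K) := by
  have hzr := h.not_mem_range_of_root hp hp0 hz
  have hwr := h.not_mem_range_of_root hp hp0 hw
  by_cases hreg : InRegularOrbit F (z : OnePoint K)
  · exact (h.root_of_regular hN hp hzr hreg hz hw).1
  · rw [not_inRegularOrbit_iff hzr] at hreg
    obtain ⟨a, b, ha, rfl⟩ := exists_affine hzr hwr hreg (h.root_of_quadratic hN hp hreg hz hw).1
    refine ⟨ofEntries a b 0 1 (by simpa), ?_⟩
    rw [ofEntries_smul_eq_coe_iff _ hzr]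
    simp

theorem aeval_frob_eq_zero {K : Type*} [Field K] [Algebra F K] {z : K} (hz : aeval z p = 0) :
    aeval (frob F K z) p = 0 := by
  rw [aeval_algHom_apply, hz, map_zero]

theorem SemiInvariant.isConj (h : SemiInvariant N p) (hN : N = Nat.card PGL(2, F))
    (hp : p.natDegree = N) (hp0 : p ≠ 0) (hF : ringChar F = 2) {z w : K} (hz : aeval z p = 0)
    (hw : aeval w p = 0) {s s' : PGL(2, F)}
    (hs : s • (z : OnePoint K) = ((frob F K z : K) : OnePoint K))
    (hs' : s' • (w : OnePoint K) = ((frob F K w : K) : OnePoint K)) : IsConj s s' := by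
  have hzr := h.not_mem_range_of_root hp hp0 hz
  have hwr := h.not_mem_range_of_root hp hp0 hw
  by_cases hreg : InRegularOrbit F (z : OnePoint K)
  · obtain ⟨t, ht⟩ := h.exists_smul_eq hN hp hp0 hz hw
    exact isConj_of_regular hzr hreg hs hs' ht
  · rw [not_inRegularOrbit_iff hzr] at hreg
    exact isConj_of_quadratic hF hzr hreg hwr (h.root_of_quadratic hN hp hreg hz hw).1 hs hs'

theorem SemiInvariant.exists_factorization_of_regular (h : SemiInvariant N p)
    (hN : N = Nat.card PGL(2, F)) (hp : p.natDegree = N) (hp0 : p ≠ 0) (hF : ringChar F = 2)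
    {z : K} (hz : aeval z p = 0) {s : PGL(2, F)}
    (hs : s • (z : OnePoint K) = ((frob F K z : K) : OnePoint K))
    (hreg : InRegularOrbit F (z : OnePoint K)) :
    ∃ S : Finset F[X], S.card = Nat.card PGL(2, F) / orderOf s ∧
      (∀ r ∈ S, r.Monic ∧ Irreducible r ∧ r.natDegree = orderOf s) ∧
      p = C p.leadingCoeff * ∏ r ∈ S, r := by
  have hzr := h.not_mem_range_of_root hp hp0 hz
  obtain ⟨S, hS1, hS2, hS3⟩ := exists_factorization (K := K) (e := 1) (r := orderOf s) hp0 (by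
    intro w hw
    have hwr := h.not_mem_range_of_root hp hp0 hw
    obtain ⟨⟨t, ht⟩, hm⟩ := h.root_of_regular hN hp hzr hreg hz hw
    refine ⟨hm, ?_⟩
    -- Another root may call for another element, but that one is conjugate to `s` and has the same
    -- order.
    obtain ⟨s', hs'⟩ := h.exists_smul_eq hN hp hp0 hw (aeval_frob_eq_zero hw)
    rw [natDegree_minpoly_eq_orderOf (isAlgebraic_iff_isIntegral.mp ⟨p, hp0, hw⟩) hwr
      (inRegularOrbit_of_smul_eq ht hreg) hs']
    obtain ⟨u, hu⟩ := isConj_iff.mp (h.isConj hN hp hp0 hF hw hz hs' hs)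
    rw [← hu]
    exact (MulAut.conj u).orderOf_eq s' |>.symm)
  refine ⟨S, ?_, hS2, by simpa using hS3⟩
  rw [mul_one, hp, hN] at hS1
  rw [← hS1, Nat.mul_div_cancel _ (orderOf_pos s)]

theorem SemiInvariant.exists_factorization_of_quadratic (h : SemiInvariant N p)
    (hN : N = Nat.card PGL(2, F)) (hp : p.natDegree = N) (hp0 : p ≠ 0)
    {z : K} (hz : aeval z p = 0) (hz2 : frob F K (frob F K z) = z) :
    ∃ S : Finset F[X], S.card = (Nat.card F ^ 2 - Nat.card F) / 2 ∧
      (∀ r ∈ S, r.Monic ∧ Irreducible r ∧ r.natDegree = 2) ∧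
      p = C p.leadingCoeff * ∏ r ∈ S, r ^ (Nat.card F + 1) := by
  obtain ⟨S, hS1, hS2, hS3⟩ := exists_factorization (K := K) (e := Nat.card F + 1) (r := 2) hp0 (by
    intro w hw
    obtain ⟨hw2, hm⟩ := h.root_of_quadratic hN hp hz2 hz hw
    exact ⟨hm, natDegree_minpoly_eq_two (isAlgebraic_iff_isIntegral.mp ⟨p, hp0, hw⟩)
      (h.not_mem_range_of_root hp hp0 hw) hw2⟩)
  refine ⟨S, ?_, hS2, hS3⟩
  rw [hp, hN, card_PGL_two, show Nat.card F ^ 3 - Nat.card F =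
      (Nat.card F ^ 2 - Nat.card F) * (Nat.card F + 1) by
    rw [Nat.sub_mul, Nat.mul_add, Nat.mul_add, ← pow_succ, mul_one, mul_one, ← sq,
      Nat.add_comm (Nat.card F ^ 2), Nat.add_sub_add_right]] at hS1
  rw [← Nat.eq_of_mul_eq_mul_right (Nat.succ_pos _) hS1, Nat.mul_div_cancel _ two_pos]

end Fibre

end PGLConj

end

/-! ### The correspondence -/

open PGLConj in
theorem theorem7p9 {F K : Type*} [Field F] [Finite F] [Field K] [Algebra F K] [IsAlgClosure F K]
    (q n : ℕ) (hF : Nat.card F = q) (hq : q = 2 ^ n)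
    (Φ : RatFunc F) (hΦ : IsInvariantGenerator Φ)
    (f g : F[X]) (hfg : IsCoprime f g)
    (hΦfg : Φ = algebraMap F[X] (RatFunc F) f / algebraMap F[X] (RatFunc F) g)
    (hf : f.natDegree = Nat.card PGL(2, F)) (hg : g.natDegree < Nat.card PGL(2, F)) :
    -- the correspondence is well posed: suitable `α` and `s` exist for every `lam`
    (∀ lam : F, ∃ α : K, value Φ α = ((algebraMap F K lam : K) : OnePoint K)) ∧
    (∀ (lam : F) (α : K), value Φ α = ((algebraMap F K lam : K) : OnePoint K) →
      ∃ s : PGL(2, F), s • (α : OnePoint K) = ((α ^ q : K) : OnePoint K)) ∧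
    -- the bijection between `P¹(F)` and the conjugacy classes
    (∃ c : OnePoint F ≃ ConjClasses PGL(2, F),
      c OnePoint.infty = ConjClasses.mk 1 ∧
      ∀ (lam : F) (α : K) (s : PGL(2, F)),
        value Φ α = ((algebraMap F K lam : K) : OnePoint K) →
        s • (α : OnePoint K) = ((α ^ q : K) : OnePoint K) →
        c (lam : OnePoint F) = ConjClasses.mk s) ∧
    -- the factorizations
    (∀ (lam : F) (α : K) (s : PGL(2, F)),
      value Φ α = ((algebraMap F K lam : K) : OnePoint K) →
      s • (α : OnePoint K) = ((α ^ q : K) : OnePoint K) →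
      (InRegularOrbit F (α : OnePoint K) →
        ∃ S : Finset F[X],
          S.card = Nat.card PGL(2, F) / orderOf s ∧
          (∀ p ∈ S, p.Monic ∧ Irreducible p ∧ p.natDegree = orderOf s) ∧
          f - C lam * g = C f.leadingCoeff * ∏ p ∈ S, p) ∧
      (¬ InRegularOrbit F (α : OnePoint K) ↔
        α ^ q ^ 2 = α ∧ α ∉ Set.range (algebraMap F K)) ∧
      (¬ InRegularOrbit F (α : OnePoint K) →
        ∃ S : Finset F[X],
          S.card = (q ^ 2 - q) / 2 ∧
          (∀ p ∈ S, p.Monic ∧ Irreducible p ∧ p.natDegree = 2) ∧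
          f - C lam * g = C f.leadingCoeff * ∏ p ∈ S, p ^ (q + 1))) := by
  have : IsAlgClosed K := IsAlgClosure.isAlgClosed F
  subst hF
  have hn : n ≠ 0 := by
    rintro rfl
    have := Finite.one_lt_card (α := F)
    omega
  have heven : Even (Nat.card F) := by
    rw [hq]
    exact (Nat.even_pow' hn).mpr even_two
  have hchar : ringChar F = 2 := by
    let := Fintype.ofFinite F
    rw [FiniteField.even_card_iff_char_two, ← Nat.card_eq_fintype_card]
    exact Nat.even_iff.mp heven
  have hpos : 0 < Nat.card PGL(2, F) := Nat.card_pos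
  have hg0 : g ≠ 0 := by
    rintro rfl
    rw [isCoprime_zero_right] at hfg
    rw [natDegree_eq_zero_of_isUnit hfg] at hf
    omega
  have hinv : ∀ M : GL (Fin 2) F, substitute M Φ = Φ := by
    have h1 : Φ ∈ invariantFunctions F := by
      rw [hΦ]
      exact IntermediateField.mem_adjoin_simple_self F Φ
    exact h1
  have hsemi := fun M => homSubst_eq_of_substitute_eq hfg hpos hf hg.le hΦfg (hinv M)
  have hgs : SemiInvariant (Nat.card PGL(2, F)) g := fun M => by
    obtain ⟨u, hu, -, h2⟩ := hsemi M
    exact ⟨u, hu, h2⟩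
  have hps : ∀ x : F, SemiInvariant (Nat.card PGL(2, F)) (f - C x * g) := fun x M => by
    obtain ⟨u, hu, h1, h2⟩ := hsemi M
    refine ⟨u, hu, ?_⟩
    rw [homSubst_sub_C_mul, h1, h2]
    ring
  have hlt : ∀ x : F, (C x * g).natDegree < f.natDegree := fun x =>
    (natDegree_C_mul_le x g).trans_lt (hf ▸ hg)
  have hdeg : ∀ x : F, (f - C x * g).natDegree = Nat.card PGL(2, F) := fun x => by
    rw [natDegree_sub_eq_left_of_natDegree_lt (hlt x), hf]
  have hlead : ∀ x : F, (f - C x * g).leadingCoeff = f.leadingCoeff := fun x =>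
    leadingCoeff_sub_of_degree_lt (degree_lt_degree (hlt x))
  have hp0 : ∀ x : F, f - C x * g ≠ 0 := fun x h0 => by
    have := hdeg x
    rw [h0, natDegree_zero] at this
    omega
  simp only [value_eq_coe_iff hfg hg0 hΦfg, ← frob_apply]
  have hroot : ∀ x : F, ∃ z : K, aeval z (f - C x * g) = 0 := fun x =>
    IsAlgClosed.exists_aeval_eq_zero K _ (natDegree_pos_iff_degree_pos.mp
      (by rw [hdeg]; exact hpos)).ne'
  have hfrob : ∀ (x : F) (z : K), aeval z (f - C x * g) = 0 →
      ∃ s : PGL(2, F), s • (z : OnePoint K) = ((frob F K z : K) : OnePoint K) := fun x z hz =>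
    (hps x).exists_smul_eq rfl (hdeg x) (hp0 x) hz (aeval_frob_eq_zero hz)
  have hnr : ∀ (x : F) (z : K), aeval z (f - C x * g) = 0 → z ∉ Set.range (algebraMap F K) :=
    fun x z hz => (hps x).not_mem_range_of_root (hdeg x) (hp0 x) hz
  refine ⟨hroot, hfrob, ?_, ?_⟩
  · choose z hz using hroot
    choose s hs using fun x => hfrob x (z x) (hz x)
    have hs1 : ∀ x, s x ≠ 1 := fun x h1 => by
      have := hs x
      rw [h1, one_smul, OnePoint.coe_eq_coe] at this
      exact hnr x _ (hz x) (frob_eq_self_iff.mp this.symm)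
    let c : OnePoint F → ConjClasses PGL(2, F) := fun x =>
      OnePoint.elim x (ConjClasses.mk 1) (fun x => ConjClasses.mk (s x))
    have hc : Function.Bijective c := by
      constructor
      · intro x y hxy
        induction x using OnePoint.rec with
        | infty =>
          induction y using OnePoint.rec with
          | infty => rfl
          | coe y =>
            exact absurd (isConj_one_right.mp (ConjClasses.mk_eq_mk_iff_isConj.mp hxy)) (hs1 y)
        | coe x =>
          induction y using OnePoint.rec with
          | infty =>
            exact absurd (isConj_one_right.mp (ConjClasses.mk_eq_mk_iff_isConj.mp hxy.symm))
              (hs1 x)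
          | coe y =>
            -- Move the point over `x` by `t` so that `s y` acts on it as Frobenius. It then shares
            -- an orbit with `z y`, which becomes a root for both `x` and `y`; as `g` does not
            -- vanish there, `x = y`.
            obtain ⟨t, ht⟩ := isConj_iff.mp (ConjClasses.mk_eq_mk_iff_isConj.mp hxy)
            obtain ⟨w, hw, htw⟩ := exists_smul_eq_coe t (hnr x _ (hz x))
            have hwx := (hps x).aeval_eq_zero (hdeg x).le (hnr x _ (hz x)) htw (hz x)
            have hsw : s y • (w : OnePoint K) = ((frob F K w : K) : OnePoint K) := by
              rw [← ht, ← htw, mul_smul, mul_smul, inv_smul_smul, hs x,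
                smul_frob (hnr x _ (hz x)) htw]
            obtain ⟨t', ht'⟩ := exists_smul_eq_of_smul_eq_frob hw (hnr y _ (hz y)) hsw (hs y)
            have hyx := (hps x).aeval_eq_zero (hdeg x).le hw ht' hwx
            have hyy := hz y
            have hgy := hgs.aeval_ne_zero rfl hg hg0 heven (hnr y _ (hz y))
            simp only [map_sub, map_mul, aeval_C] at hyx hyy
            congr 1
            apply (algebraMap F K).injective
            apply mul_right_cancel₀ hgy
            linear_combination hyy - hyx
      · intro k
        obtain ⟨t, rfl⟩ := ConjClasses.mk_surjective k
        by_cases ht : t = 1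
        · exact ⟨OnePoint.infty, by rw [ht]; rfl⟩
        · obtain ⟨w, hw, htw⟩ := exists_smul_eq_frob (K := K) ht
          have hgw := hgs.aeval_ne_zero rfl hg hg0 heven hw
          have hgfw := hgs.aeval_ne_zero rfl hg hg0 heven (frob_not_mem_range hw)
          -- `Φ(w^q) = Φ(t w) = Φ(w)`, so the value is Frobenius-fixed and lies in `F`.
          have hcross : aeval (frob F K w) f * aeval w g = aeval w f * aeval (frob F K w) g := by
            obtain ⟨M, rfl⟩ := Matrix.ProjGenLinGroup.mk_surjective t
            rw [mk_smul_eq_moebius M hw, OnePoint.coe_eq_coe] at htw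
            obtain ⟨u, hu, h1, h2⟩ := hsemi M
            have e1 := aeval_homSubst M hf.le (denom_ne_zero M hw)
            have e2 := aeval_homSubst M hg.le (denom_ne_zero M hw)
            rw [h1, htw, map_mul, aeval_C] at e1
            rw [h2, htw, map_mul, aeval_C] at e2
            apply mul_left_cancel₀ (pow_ne_zero (Nat.card PGL(2, F)) (denom_ne_zero M hw))
            linear_combination aeval w f * e2 - aeval w g * e1
          obtain ⟨x, hx⟩ := frob_eq_self_iff.mp
            (show frob F K (aeval w f / aeval w g) = aeval w f / aeval w g by
              rw [map_div₀, ← aeval_algHom_apply, ← aeval_algHom_apply,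
                div_eq_div_iff hgfw hgw, hcross])
          have hxw : aeval w (f - C x * g) = 0 := by
            rw [map_sub, map_mul, aeval_C, hx, div_mul_cancel₀ _ hgw, sub_self]
          exact ⟨x, ConjClasses.mk_eq_mk_iff_isConj.mpr
            ((hps x).isConj rfl (hdeg x) (hp0 x) hchar (hz x) hxw (hs x) htw)⟩
    refine ⟨Equiv.ofBijective c hc, rfl, ?_⟩
    intro x w t hw ht
    exact ConjClasses.mk_eq_mk_iff_isConj.mpr
      ((hps x).isConj rfl (hdeg x) (hp0 x) hchar (hz x) hw (hs x) ht)
  · intro x w t hw ht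
    have hwr := hnr x w hw
    refine ⟨fun hreg => ?_, ?_, fun hreg => ?_⟩
    · rw [← hlead x]
      exact (hps x).exists_factorization_of_regular rfl (hdeg x) (hp0 x) hchar hw ht hreg
    · rw [not_inRegularOrbit_iff hwr, and_iff_left hwr, ← frob_iterate_apply]
      rfl
    · rw [← hlead x]
      exact (hps x).exists_factorization_of_quadratic rfl (hdeg x) (hp0 x) hw
        ((not_inRegularOrbit_iff hwr).mp hreg)
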